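/- \textbf{Setting.} Fix countably many relation symbols of every arity $n\ge 1$ and a countably infinite set of constants. First-order (FO) formulas are built from atoms $R(\vec x)$ and $x=y$ (no constants) by $\neg,\wedge,\vee,\exists,\forall$, where $\alpha\to\varphi$ abbreviates $\neg\alpha\vee\varphi$. Guarded formulas (GF) are built from atoms and equalities by the Boolean connectives and guarded quantification $\exists\vec y(\alpha\wedge\varphi)$, $\forall\vec y(\alpha\to\varphi)$, where $\alpha$ is an atom or equality that contains all variables $\vec y$ and all free variables of the guarded formula $\varphi$; $\mathrm{GF}^3$ is the set of guarded formulas that use only three fixed variables. $\mathcal{ALC}$-concepts are given by $C,D::=A\mid\neg C\mid C\sqcap D\mid\exists R.C$ with $A$ a unary and $R$ a binary relation symbol, and are identified with their standard translations into FO-formulas with one free variable. Let $\mathcal L$ be a set of FO-formulas. A \emph{labeled $\mathcal L$-KB} $(\mathcal K,P,N)$ consists of $\mathcal K=(\mathcal O,\mathcal D)$, where $\mathcal O$ is a finite set of sentences from $\mathcal L$ and $\mathcal D$ is a finite set of ground atoms, and of finite non-empty sets $P,N$ of tuples, all of the same length $n$, of constants that occur in $\mathcal D$. Models of $\mathcal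 K$ are relational structures with non-empty domain, interpreting all relation symbols and constants, that satisfy $\mathcal O$ and $\mathcal D$; distinct constants may denote the same element. Let $\mathrm{sig}(\cdot)$ be the set of relation symbols that occur, and let $\Sigma\subseteq\mathrm{sig}(\mathcal K)$. Let $\mathcal L_S$ be a set of FO-formulas. Then $(\mathcal K,P,N)$ is \emph{projectively $\mathcal L_S(\Sigma)$-separable} if there is $\varphi(\vec x)\in\mathcal L_S$, with $\vec x$ a tuple of $n$ distinct variables containing all free variables of $\varphi$, such that $\mathrm{sig}(\mathcal K)\cap\mathrm{sig}(\varphi)\subseteq\Sigma$, $\mathcal K\models\varphi(\vec a)$ for all $\vec a\in P$, and $\mathcal K\not\models\varphi(\vec a)$ for all $\vec a\in N$. It is \emph{non-projectively $\mathcal L_S(\Sigma)$-separable} if there is such a $\varphi$ with $\mathrm{sig}(\varphi)\subseteq\Sigma$. \textbf{Theorem.} Let $\mathcal L$ be any set of FO-formulas that contains $\mathrm{GF}^3$. \begin{enumerate} \item Projective and non-projective $\mathcal L$-separability with signature are undecidable: there is no algorithm that, given a labeled $\mathcal L$-KB $(\mathcal K,P,N)$ and a signature $\Sigma\subseteq\mathrm{sig}(\mathcal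 K)$, decides whether $(\mathcal K,P,N)$ is projectively $\mathcal L(\Sigma)$-separable, and none that decides whether it is non-projectively $\mathcal L(\Sigma)$-separable. \item This remains true when the separating formula is required to be an $\mathcal{ALC}$-concept: there is no algorithm that, given a labeled $\mathcal L$-KB $(\mathcal K,P,N)$ whose examples are single constants ($n=1$) and whose database uses only unary and binary relation symbols, and a signature $\Sigma\subseteq\mathrm{sig}(\mathcal K)$, decides whether $(\mathcal K,P,N)$ is projectively $\mathcal{ALC}(\Sigma)$-separable, and none that decides whether it is non-projectively $\mathcal{ALC}(\Sigma)$-separable. \end{enumerate} An algorithm is only required to halt with the correct answer on inputs of the stated form. -/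

import Mathlib

namespace Separability

/-! ### First-order formulas with named variables

Variables and constants are natural numbers.  Named variables (rather than de Bruijn indices) are
needed to speak about finite-variable fragments, where a variable may be quantified repeatedly. -/

/-- Relation symbols: the symbol `⟨k, i⟩` is the `i`-th symbol of arity `k + 1`, so that there are
countably many relation symbols of every arity `≥ 1`. -/
structure RelSym where
  arityPred : ℕ
  idx : ℕ

def RelSym.arity (R : RelSym) : ℕ := R.arityPred + 1

/-- First-order formulas over equality and relation symbols, without constants. -/
inductive FOFormula : Type
  | eq (x y : ℕ) : FOFormula
  | rel (R : RelSym) (args : Fin R.arity → ℕ) : FOFormula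
  | neg (φ : FOFormula) : FOFormula
  | conj (φ ψ : FOFormula) : FOFormula
  | disj (φ ψ : FOFormula) : FOFormula
  | ex (x : ℕ) (φ : FOFormula) : FOFormula
  | all (x : ℕ) (φ : FOFormula) : FOFormula

namespace FOFormula

/-- Implication, as the usual abbreviation. -/
def imp (φ ψ : FOFormula) : FOFormula := disj (neg φ) ψ

/-- `∃ y₁ … ∃ yₖ φ` -/
def exs (ys : List ℕ) (φ : FOFormula) : FOFormula := ys.foldr ex φ

/-- `∀ y₁ … ∀ yₖ φ` -/
def alls (ys : List ℕ) (φ : FOFormula) : FOFormula := ys.foldr all φ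

/-- Free variables. -/
def freeVars : FOFormula → Set ℕ
  | eq x y => {x, y}
  | rel _ args => Set.range args
  | neg φ => freeVars φ
  | conj φ ψ => freeVars φ ∪ freeVars ψ
  | disj φ ψ => freeVars φ ∪ freeVars ψ
  | ex x φ => freeVars φ \ {x}
  | all x φ => freeVars φ \ {x}

/-- All variables that occur, free or bound. -/
def vars : FOFormula → Set ℕ
  | eq x y => {x, y}
  | rel _ args => Set.range args
  | neg φ => vars φ
  | conj φ ψ => vars φ ∪ vars ψ
  | disj φ ψ => vars φ ∪ vars ψ
  | ex x φ => insert x (vars φ)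
  | all x φ => insert x (vars φ)

/-- The set of relation symbols that occur in a formula. -/
def sig : FOFormula → Set RelSym
  | eq _ _ => ∅
  | rel R _ => {R}
  | neg φ => sig φ
  | conj φ ψ => sig φ ∪ sig ψ
  | disj φ ψ => sig φ ∪ sig ψ
  | ex _ φ => sig φ
  | all _ φ => sig φ

def IsSentence (φ : FOFormula) : Prop := φ.freeVars = ∅

/-- Atomic formulas `R(x₁, …, xₙ)` and equalities `x = y`. -/
def IsAtomic : FOFormula → Prop
  | eq _ _ => True
  | rel _ _ => True
  | _ => False

end FOFormula

open FOFormula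

/-! ### The guarded fragment and its three-variable fragment -/

/-- The guarded fragment: Boolean combinations and guarded quantification
`∃ ys (α ∧ φ)`, `∀ ys (α → φ)`, where the guard `α` is atomic and contains all the quantified
variables `ys` and all the free variables of `φ`. -/
inductive IsGuarded : FOFormula → Prop
  | eq (x y : ℕ) : IsGuarded (.eq x y)
  | rel (R : RelSym) (args : Fin R.arity → ℕ) : IsGuarded (.rel R args)
  | neg {φ : FOFormula} : IsGuarded φ → IsGuarded (.neg φ)
  | conj {φ ψ : FOFormula} : IsGuarded φ → IsGuarded ψ → IsGuarded (.conj φ ψ)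
  | disj {φ ψ : FOFormula} : IsGuarded φ → IsGuarded ψ → IsGuarded (.disj φ ψ)
  | exs {ys : List ℕ} {α φ : FOFormula} : ys ≠ [] → ys.Nodup → α.IsAtomic →
      (∀ y ∈ ys, y ∈ α.freeVars) → φ.freeVars ⊆ α.freeVars → IsGuarded φ →
      IsGuarded (FOFormula.exs ys (.conj α φ))
  | alls {ys : List ℕ} {α φ : FOFormula} : ys ≠ [] → ys.Nodup → α.IsAtomic →
      (∀ y ∈ ys, y ∈ α.freeVars) → φ.freeVars ⊆ α.freeVars → IsGuarded φ →
      IsGuarded (FOFormula.alls ys (.imp α φ))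

/-- `GF³`: the guarded formulas in which only three fixed variables are used (with reuse). -/
def GF3 : Set FOFormula := {φ | IsGuarded φ ∧ φ.vars ⊆ {0, 1, 2}}

/-! ### The description logic `ALC` -/

/-- `ALC`-concepts: concept names are the unary, role names the binary relation symbols. -/
inductive ALCConcept : Type
  | name (A : ℕ) : ALCConcept
  | neg (C : ALCConcept) : ALCConcept
  | inter (C D : ALCConcept) : ALCConcept
  | ex (R : ℕ) (C : ALCConcept) : ALCConcept

/-- The standard translation of a concept into a formula with the free variable `x`;
`y` is the other variable, and the two are swapped below each existential restriction. -/
def ALCConcept.toFO : ALCConcept → ℕ → ℕ → FOFormula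
  | name A, x, _ => .rel ⟨0, A⟩ (fun _ => x)
  | neg C, x, y => .neg (C.toFO x y)
  | inter C D, x, y => .conj (C.toFO x y) (D.toFO x y)
  | ex R C, x, y => .ex y (.conj (.rel ⟨1, R⟩ (![x, y] : Fin 2 → ℕ)) (C.toFO y x))

/-- `ALC`, as a fragment of first-order logic. -/
def ALC : Set FOFormula := {φ | ∃ C : ALCConcept, φ = C.toFO 0 1}

/-! ### Relational structures and satisfaction -/

/-- Relational structures. Different constants may denote the same element. -/
structure RelStructure where
  dom : Type
  nonempty : Nonempty dom
  rel : (R : RelSym) → (Fin R.arity → dom) → Prop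
  const : ℕ → dom

/-- Satisfaction of a formula in a structure under an assignment. -/
def RelStructure.Sat (A : RelStructure) : FOFormula → (ℕ → A.dom) → Prop
  | .eq x y, v => v x = v y
  | .rel R args, v => A.rel R (fun i => v (args i))
  | .neg φ, v => ¬ A.Sat φ v
  | .conj φ ψ, v => A.Sat φ v ∧ A.Sat ψ v
  | .disj φ ψ, v => A.Sat φ v ∨ A.Sat ψ v
  | .ex x φ, v => ∃ d : A.dom, A.Sat φ (Function.update v x d)
  | .all x φ, v => ∀ d : A.dom, A.Sat φ (Function.update v x d)

/-! ### Knowledge bases, labeled knowledge bases and separability -/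

/-- Ground atoms `R(a₁, …, aₙ)`. -/
structure GroundAtom where
  R : RelSym
  args : Fin R.arity → ℕ

/-- The raw inputs of the separability problems: an ontology, a database, example tuples of length
`n`, and a signature. Finite sets are presented by lists. -/
structure Input where
  ontology : List FOFormula
  database : List GroundAtom
  n : ℕ
  pos : List (Fin n → ℕ)
  neg : List (Fin n → ℕ)
  signature : List RelSym

namespace Input

/-- The constants that occur in the database. -/
def cons (I : Input) : Set ℕ := {c | ∃ g ∈ I.database, c ∈ Set.range g.args}

/-- The relation symbols that occur in the knowledge base. -/
def sigKB (I : Input) : Set RelSym :=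
  {R | (∃ φ ∈ I.ontology, R ∈ φ.sig) ∨ ∃ g ∈ I.database, R = g.R}

/-- The given signature `Σ`, as a set. -/
def sigma (I : Input) : Set RelSym := {R | R ∈ I.signature}

/-- `I` consists of a labeled `L`-KB and a signature of symbols of the knowledge base. -/
structure IsLabeledKB (L : Set FOFormula) (I : Input) : Prop where
  ontology_mem : ∀ φ ∈ I.ontology, φ ∈ L ∧ φ.IsSentence
  pos_nonempty : I.pos ≠ []
  neg_nonempty : I.neg ≠ []
  pos_cons : ∀ a ∈ I.pos, ∀ i, a i ∈ I.cons
  neg_cons : ∀ a ∈ I.neg, ∀ i, a i ∈ I.cons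
  sigma_subset : I.sigma ⊆ I.sigKB

/-- `A` is a model of the knowledge base. -/
def IsModel (I : Input) (A : RelStructure) : Prop :=
  (∀ φ ∈ I.ontology, ∀ v : ℕ → A.dom, A.Sat φ v) ∧
  ∀ g ∈ I.database, A.rel g.R (fun i => A.const (g.args i))

/-- The knowledge base entails `φ(a)`, where `φ = φ(x)` for a tuple `x` of variables. -/
def Entails (I : Input) (φ : FOFormula) (x : Fin I.n → ℕ) (a : Fin I.n → ℕ) : Prop :=
  ∀ A : RelStructure, I.IsModel A →
    ∀ v : ℕ → A.dom, (∀ i, v (x i) = A.const (a i)) → A.Sat φ v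

/-- `φ(x)` `Σ`-separates the labeled knowledge base; `x` is a tuple of distinct variables that
contains all the free variables of `φ`. -/
structure Separates (I : Input) (φ : FOFormula) (x : Fin I.n → ℕ) : Prop where
  injective : Function.Injective x
  freeVars_subset : φ.freeVars ⊆ Set.range x
  sig_subset : I.sigKB ∩ φ.sig ⊆ I.sigma
  pos : ∀ a ∈ I.pos, I.Entails φ x a
  neg : ∀ a ∈ I.neg, ¬ I.Entails φ x a

/-- Projective `LS(Σ)`-separability: helper symbols that do not occur in the knowledge base are
admitted. -/
def ProjSeparable (LS : Set FOFormula) (I : Input) : Prop :=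
  ∃ φ ∈ LS, ∃ x : Fin I.n → ℕ, I.Separates φ x

/-- Non-projective `LS(Σ)`-separability: only symbols from `Σ` are admitted. -/
def NonProjSeparable (LS : Set FOFormula) (I : Input) : Prop :=
  ∃ φ ∈ LS, ∃ x : Fin I.n → ℕ, I.Separates φ x ∧ φ.sig ⊆ I.sigma

end Input

/-! ### Coding inputs by natural numbers -/

def RelSym.code (R : RelSym) : ℕ := Nat.pair R.arityPred R.idx

def tupleCode {n : ℕ} (a : Fin n → ℕ) : ℕ := Encodable.encode (List.ofFn a)

def FOFormula.code : FOFormula → ℕ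
  | .eq x y => Nat.pair 0 (Nat.pair x y)
  | .rel R args => Nat.pair 1 (Nat.pair R.code (tupleCode args))
  | .neg φ => Nat.pair 2 φ.code
  | .conj φ ψ => Nat.pair 3 (Nat.pair φ.code ψ.code)
  | .disj φ ψ => Nat.pair 4 (Nat.pair φ.code ψ.code)
  | .ex x φ => Nat.pair 5 (Nat.pair x φ.code)
  | .all x φ => Nat.pair 6 (Nat.pair x φ.code)

def GroundAtom.code (g : GroundAtom) : ℕ := Nat.pair g.R.code (tupleCode g.args)

/-- The Gödel number of an input. -/
def Input.code (I : Input) : ℕ :=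
  Encodable.encode
    (I.ontology.map FOFormula.code, I.database.map GroundAtom.code, I.n,
      I.pos.map tupleCode, I.neg.map tupleCode, I.signature.map RelSym.code)

theorem RelSym.code_injective : Function.Injective RelSym.code := by
  rintro ⟨k, i⟩ ⟨l, j⟩ h
  simpa [RelSym.code, Nat.pair_eq_pair] using h

theorem tupleCode_injective {n : ℕ} : Function.Injective (tupleCode (n := n)) := by
  intro a b h
  exact List.ofFn_injective (Encodable.encode_injective h)

theorem FOFormula.code_injective : Function.Injective FOFormula.code := by
  intro φ
  induction φ with
  | eq x y => intro ψ h; cases ψ <;> simp_all [FOFormula.code, Nat.pair_eq_pair]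
  | rel R args =>
    intro ψ h
    cases ψ with
    | rel S args' =>
      simp only [FOFormula.code, Nat.pair_eq_pair, true_and] at h
      obtain ⟨h1, h2⟩ := h
      obtain rfl := RelSym.code_injective h1
      rw [tupleCode_injective h2]
    | _ => simp [FOFormula.code, Nat.pair_eq_pair] at h
  | neg φ ih =>
    intro ψ h
    cases ψ with
    | neg ψ =>
      simp only [FOFormula.code, Nat.pair_eq_pair, true_and] at h
      rw [ih h]
    | _ => simp [FOFormula.code, Nat.pair_eq_pair] at h
  | conj φ φ' ih ih' =>
    intro ψ h
    cases ψ with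
    | conj ψ ψ' =>
      simp only [FOFormula.code, Nat.pair_eq_pair, true_and] at h
      rw [ih h.1, ih' h.2]
    | _ => simp [FOFormula.code, Nat.pair_eq_pair] at h
  | disj φ φ' ih ih' =>
    intro ψ h
    cases ψ with
    | disj ψ ψ' =>
      simp only [FOFormula.code, Nat.pair_eq_pair, true_and] at h
      rw [ih h.1, ih' h.2]
    | _ => simp [FOFormula.code, Nat.pair_eq_pair] at h
  | ex x φ ih =>
    intro ψ h
    cases ψ with
    | ex y ψ =>
      simp only [FOFormula.code, Nat.pair_eq_pair, true_and] at h
      rw [h.1, ih h.2]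
    | _ => simp [FOFormula.code, Nat.pair_eq_pair] at h
  | all x φ ih =>
    intro ψ h
    cases ψ with
    | all y ψ =>
      simp only [FOFormula.code, Nat.pair_eq_pair, true_and] at h
      rw [h.1, ih h.2]
    | _ => simp [FOFormula.code, Nat.pair_eq_pair] at h

theorem GroundAtom.code_injective : Function.Injective GroundAtom.code := by
  rintro ⟨R, a⟩ ⟨S, b⟩ h
  simp only [GroundAtom.code, Nat.pair_eq_pair] at h
  obtain ⟨h1, h2⟩ := h
  obtain rfl := RelSym.code_injective h1
  rw [tupleCode_injective h2]

theorem Input.code_injective : Function.Injective Input.code := by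
  rintro ⟨o, d, n, p, q, s⟩ ⟨o', d', n', p', q', s'⟩ h
  have h := Encodable.encode_injective h
  simp only [Prod.mk.injEq] at h
  obtain ⟨h1, h2, rfl, h4, h5, h6⟩ := h
  rw [List.map_injective_iff.mpr FOFormula.code_injective h1,
    List.map_injective_iff.mpr GroundAtom.code_injective h2,
    List.map_injective_iff.mpr tupleCode_injective h4,
    List.map_injective_iff.mpr tupleCode_injective h5,
    List.map_injective_iff.mpr RelSym.code_injective h6]

/-- The problem with the given admissible inputs and the given question is undecidable: no
algorithm halts with the correct answer on (the code of) every admissible input. Nothing is asked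
of the algorithm on other inputs. -/
def Undecidable (admissible question : Input → Prop) : Prop :=
  ¬ ∃ f : ℕ →. Bool, Partrec f ∧
    ∀ I : Input, admissible I → ∃ b : Bool, b ∈ f I.code ∧ (b = true ↔ question I)

end Separability

namespace Separability

open Turing.ToPartrec (Code)

/-! The halting problem of a fixed program `c` on inputs `[n]` is reduced to separability. Roles in
Σ encode data trees and evaluation derivations, so a halting computation yields a finite object of
type `Pt` whose shape is expressible by an `ALC`-concept. The symbols outside Σ are helpers: a
guard, a goal symbol, disagreement of two elements, and for each subprogram the claim of not being a
derivation for it. Guarded axioms with three variables demand that every claim of disagreement or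
failure have a local reason (`Coherent`). The goal axiom says that a goal element, such as the
positive example, is claimed not to be a derivation for `c` unless it lacks the input `[n]`.

Suppose `c` halts on `[n]`. A correct finite derivation offers no reason for failure
(`not_mis_of_along`, `exists_derives`), so no goal element can have its shape in any model. The
negated shape concept therefore holds at the positive example. It is refuted at the negative example
by an expansion of `freeStructure`, where the derivation itself is an element.

Suppose `c` does not halt on `[n]`. In every structure, actual disagreement and actual failure form
a coherent family (`coherent_not_good`, resting on `good_of_clause`), and no element is a correct
derivation for `c` with input `[n]`. Hence in any model the helpers can be reinterpreted and the
positive constant moved onto the negative example, and the result is again a model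
(`isModel_expand`). A separating formula sees neither the helpers nor the constants, so it would be
entailed at the negative example too (`dom_of_separates`). Nothing about the separating language
enters here, so one reduction serves all four problems. -/

/-- Binary trees, the data type of computations. -/
inductive Tr : Type
  | leaf : Tr
  | node (l r : Tr) : Tr

namespace Tr

def ofNat : ℕ → Tr
  | 0 => leaf
  | n + 1 => node leaf (ofNat n)

def ofList : List ℕ → Tr
  | [] => leaf
  | n :: v => node (ofNat n) (ofList v)

end Tr

open Tr

/-! ### Trees and derivations in a structure with roles

The roles are `0, 1` (left and right subtree of a data node) and, at a derivation node, `2` (input),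
`3` (output) and `4, 5` (subderivations). -/

section Core

variable {D : Type} (E : ℕ → D → D → Prop)

/-- Successors along `p` exist all the way, and all of them have the property `P`. -/
def Along : List ℕ → (D → Prop) → D → Prop
  | [], P, x => P x
  | r :: p, P, x => (∃ y, E r x y) ∧ ∀ y, E r x y → Along p P y

/-- The tree `t` is represented at `x`. -/
def Val : Tr → D → Prop
  | .leaf, x => ¬ ∃ y, E 0 x y
  | .node l r, x => Along E [0] (Val l) x ∧ Along E [1] (Val r) x

/-- The same tree is represented at `u` and `v`. -/
def Agree (u v : D) : Prop := ∃ t, Val E t u ∧ Val E t v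

/-- From `u` along `p` and from `v` along `q` one gets stuck, or reaches a pair in `N`. -/
def Mis (N : D → D → Prop) : List ℕ → List ℕ → D → D → Prop
  | r :: p, q, u, v => (¬ ∃ z, E r u z) ∨ ∃ z, E r u z ∧ Mis N p q z v
  | [], r :: q, u, v => (¬ ∃ z, E r v z) ∨ ∃ z, E r v z ∧ Mis N [] q u z
  | [], [], u, v => N u v

/-- Local conditions on a derivation node. -/
inductive Cond : Type
  | eqn (p q : List ℕ) : Cond
  | leaf (p : List ℕ) : Cond
  | child (r : ℕ) (c : Code) : Cond

/-- A condition fails at `x`, where `N` stands for disagreement and `X c` for not being a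
derivation for `c`. -/
def Cond.Fails (N : D → D → Prop) (X : Code → D → Prop) (x : D) : Cond → Prop
  | .eqn p q => Mis E N p q x x
  | .leaf p => ¬ Along E p (Val E .leaf) x
  | .child r c => ¬ Along E [r] (fun y => ¬ X c y) x

open Cond in
/-- A node is a derivation for `c` if all the conditions of one of these clauses hold. -/
def clauses : Code → List (List Cond)
  | .zero' => [[leaf [3, 0], eqn [3, 1] [2]]]
  | .succ => [[leaf [2], leaf [3, 0, 0], leaf [3, 0, 1], leaf [3, 1]],
      [leaf [3, 0, 0], eqn [3, 0, 1] [2, 0], leaf [3, 1], eqn [2, 1] [2, 1]]]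
  | .tail => [[leaf [2], leaf [3]], [eqn [2, 0] [2, 0], eqn [2, 1] [3]]]
  | .cons f g => [[child 4 f, child 5 g, eqn [2] [4, 2], eqn [2] [5, 2], eqn [3, 1] [5, 3],
        leaf [4, 3], leaf [3, 0]],
      [child 4 f, child 5 g, eqn [2] [4, 2], eqn [2] [5, 2], eqn [3, 1] [5, 3],
        eqn [4, 3] [4, 3], eqn [3, 0] [4, 3, 0]]]
  | .comp f g => [[child 4 g, child 5 f, eqn [2] [4, 2], eqn [4, 3] [5, 2], eqn [3] [5, 3]]]
  | .case f g => [[child 4 f, leaf [2], leaf [4, 2], eqn [3] [4, 3]],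
      [child 4 f, leaf [2, 0], eqn [2, 1] [4, 2], eqn [3] [4, 3]],
      [child 4 g, leaf [2, 0, 0], eqn [2, 0, 1] [4, 2, 0], eqn [2, 1] [4, 2, 1], eqn [3] [4, 3]]]
  | .fix f => [[child 4 f, eqn [2] [4, 2], leaf [4, 3], leaf [3]],
      [child 4 f, eqn [2] [4, 2], leaf [4, 3, 0], eqn [4, 3, 1] [3]],
      [child 4 f, child 5 (.fix f), eqn [2] [4, 2], eqn [4, 3] [4, 3],
        eqn [4, 3, 0, 0] [4, 3, 0, 0], eqn [4, 3, 1] [5, 2], eqn [3] [5, 3]]]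

/-- Pairs in `N` have a reason to disagree, and elements in `X c`, for `c` in `S`, have a reason
not to be derivations for `c`. -/
structure Coherent (S : List Code) (N : D → D → Prop) (X : Code → D → Prop) : Prop where
  mis : ∀ u v, N u v → ((∃ z, E 0 u z) ∨ ∃ z, E 0 v z) ∧
    (Mis E N [0] [0] u v ∨ Mis E N [1] [1] u v)
  fails : ∀ c ∈ S, ∀ x, X c x → ∀ cl ∈ clauses c, ∃ k ∈ cl, k.Fails E N X x

/-- `c` maps the list coded by `i`, if any, to the list coded by `o`. -/
def Maps (c : Code) (i o : Tr) : Prop := ∀ v, i = ofList v → ∃ w ∈ c.eval v, o = ofList w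

/-- `x` represents a correct pair of an input and an output of `c`. -/
def Good (c : Code) (x : D) : Prop :=
  ∃ i o, Along E [2] (Val E i) x ∧ Along E [3] (Val E o) x ∧ Maps c i o

variable {E}

/-! ### Trees reached along paths, and disagreement -/

theorem Along.mono {p : List ℕ} {P Q : D → Prop} (h : ∀ y, P y → Q y) :
    ∀ {x : D}, Along E p P x → Along E p Q x := by
  induction p with
  | nil => exact fun {x} hx => h x hx
  | cons r p ih => exact fun {x} hx => ⟨hx.1, fun y hy => ih (hx.2 y hy)⟩

theorem Along.and {p : List ℕ} {P Q : D → Prop} :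
    ∀ {x : D}, Along E p P x → Along E p Q x → Along E p (fun y => P y ∧ Q y) x := by
  induction p with
  | nil => exact fun {x} h h' => ⟨h, h'⟩
  | cons r p ih => exact fun {x} h h' => ⟨h.1, fun y hy => ih (h.2 y hy) (h'.2 y hy)⟩

theorem Along.exists {p : List ℕ} {P : D → Prop} :
    ∀ {x : D}, Along E p P x → ∃ y, P y := by
  induction p with
  | nil => exact fun {x} h => ⟨x, h⟩
  | cons r p ih => exact fun {x} h => let ⟨y, hy⟩ := h.1; ih (h.2 y hy)

theorem along_append {p q : List ℕ} {P : D → Prop} :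
    ∀ {x : D}, Along E (p ++ q) P x ↔ Along E p (Along E q P) x := by
  induction p with
  | nil => exact Iff.rfl
  | cons r p ih => intro x; simp only [List.cons_append, Along, ih]

/-- Roles need not be functional. Since `Along` demands a successor at each step, two facts along
the same path still meet at a common endpoint, via `Along.and` and `Along.exists`; this is the
recurring argument. -/
theorem Val.unique {t t' : Tr} {x : D} (h : Val E t x) (h' : Val E t' x) : t = t' := by
  induction t generalizing t' x with
  | leaf => cases t' with
    | leaf => rfl
    | node l r => exact absurd h'.1.1 h
  | node l r ihl ihr => cases t' with
    | leaf => exact absurd h.1.1 h'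
    | node l' r' =>
      obtain ⟨y, hy, hy'⟩ := (h.1.and h'.1).exists
      obtain ⟨z, hz, hz'⟩ := (h.2.and h'.2).exists
      rw [ihl hy hy', ihr hz hz']

theorem along_val_unique {p : List ℕ} {t t' : Tr} {x : D} (h : Along E p (Val E t) x)
    (h' : Along E p (Val E t') x) : t = t' :=
  let ⟨_, hy, hy'⟩ := (h.and h').exists
  hy.unique hy'

theorem along_node {p : List ℕ} {l r : Tr} {x : D} (hl : Along E (p ++ [0]) (Val E l) x)
    (hr : Along E (p ++ [1]) (Val E r) x) : Along E p (Val E (.node l r)) x :=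
  (along_append.1 hl).and (along_append.1 hr)

theorem along_left {p : List ℕ} {l r : Tr} {x : D} (h : Along E p (Val E (.node l r)) x) :
    Along E (p ++ [0]) (Val E l) x :=
  along_append.2 (h.mono fun _ hy => hy.1)

theorem along_right {p : List ℕ} {l r : Tr} {x : D} (h : Along E p (Val E (.node l r)) x) :
    Along E (p ++ [1]) (Val E r) x :=
  along_append.2 (h.mono fun _ hy => hy.2)

theorem exists_node_of_along {p : List ℕ} {t l : Tr} {x : D} (h : Along E p (Val E t) x)
    (hl : Along E (p ++ [0]) (Val E l) x) : ∃ r, t = .node l r := by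
  obtain ⟨y, hy, hy'⟩ := (h.and (along_append.1 hl)).exists
  cases t with
  | leaf => exact absurd hy'.1 hy
  | node l' r =>
    obtain ⟨z, hz, hz'⟩ := (hy.1.and hy').exists
    exact ⟨r, by rw [hz.unique hz']⟩

/-- De Morgan duality: `Mis` is existential over successors and counts being stuck as success, so
its negation is universal with existence, that is, two nested `Along`. -/
theorem not_mis {N : D → D → Prop} {p q : List ℕ} {u v : D} :
    ¬ Mis E N p q u v ↔ Along E p (fun u => Along E q (fun v => ¬ N u v) v) u := by
  induction p generalizing u with
  | nil =>
    induction q generalizing v with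
    | nil => simp only [Mis, Along]
    | cons r q ih =>
      simp only [Along] at ih
      simp only [Mis, Along, ← ih]
      push Not
      rfl
  | cons r p ih =>
    simp only [Mis, Along, ← ih]
    push Not
    rfl

theorem mis_mono {N : D → D → Prop} {p q : List ℕ} {u v : D} {P Q : D → Prop}
    (h : Mis E N p q u v) (hp : Along E p P u) (hq : Along E q Q v) :
    ∃ u v, N u v ∧ P u ∧ Q v := by
  by_contra! hn
  exact not_mis.2 (hp.mono fun u hu => hq.mono fun v hv hN => hn u v hN hu hv) h

/-- All endpoints of `p` agree with all endpoints of `q`. One such pair fixes a tree, and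
`Val.unique` spreads it to all endpoints. With `p = q` the condition says just that some finite tree
is represented along `p`. -/
theorem agree_iff_along {p q : List ℕ} {x : D} :
    ¬ Mis E (fun u v => ¬ Agree E u v) p q x x ↔
      ∃ t, Along E p (Val E t) x ∧ Along E q (Val E t) x := by
  simp only [not_mis, not_not]
  constructor
  · intro h
    obtain ⟨u, hu⟩ := h.exists
    obtain ⟨v, t, htu, htv⟩ := hu.exists
    refine ⟨t, h.mono ?_, hu.mono ?_⟩
    · intro u' hu'
      obtain ⟨v', ⟨s, hs, hs'⟩, ⟨s', hs1, hs1'⟩⟩ := (hu'.and hu).exists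
      obtain rfl := hs'.unique hs1'
      obtain rfl := hs1.unique htu
      exact hs
    · rintro v' ⟨s, hs, hs'⟩
      obtain rfl := hs.unique htu
      exact hs'
  · rintro ⟨t, hp, hq⟩
    exact hp.mono fun u hu => hq.mono fun v hv => ⟨t, hu, hv⟩

/-- A claimed disagreement is pushed down the common tree: at a leaf the first half of the coherence
condition fails, and at a node both children already agree by induction. -/
theorem not_mis_of_along {S : List Code} {N : D → D → Prop} {X : Code → D → Prop}
    (hN : Coherent E S N X) {p q : List ℕ} {t : Tr} {u v : D}
    (hp : Along E p (Val E t) u) (hq : Along E q (Val E t) v) : ¬ Mis E N p q u v := by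
  intro h
  induction t generalizing p q u v with
  | leaf =>
    obtain ⟨u, v, hn, hu, hv⟩ := mis_mono h hp hq
    exact (hN.mis u v hn).1.elim hu hv
  | node l r ihl ihr =>
    obtain ⟨u, v, hn, hu, hv⟩ := mis_mono h hp hq
    exact (hN.mis u v hn).2.elim (ihl hu.1 hv.1) (ihr hu.2 hv.2)

theorem Along.maps {r : ℕ} {c : Code} {x : D} {i o : Tr} (h : Along E [r] (Good E c) x)
    (hi : Along E [r, 2] (Val E i) x) (ho : Along E [r, 3] (Val E o) x) : Maps c i o := by
  obtain ⟨y, ⟨i', o', hi', ho', hm⟩, hy, hy'⟩ := (h.and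
    ((along_append (p := [r]) (q := [2]).1 hi).and (along_append (p := [r]) (q := [3]).1 ho))).exists
  rwa [along_val_unique hy hi', along_val_unique hy' ho']

end Core

/-! ### Inversion of the tree coding and of program evaluation -/

theorem ofList_eq_leaf {v : List ℕ} (h : leaf = ofList v) : v = [] := by
  cases v with
  | nil => rfl
  | cons n v => simp [ofList] at h

theorem ofList_eq_node {v : List ℕ} {l r : Tr} (h : node l r = ofList v) :
    ∃ n w, v = n :: w ∧ l = ofNat n ∧ r = ofList w := by
  cases v with
  | nil => simp [ofList] at h
  | cons n v =>
    simp only [ofList, node.injEq] at h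
    exact ⟨n, v, rfl, h⟩

theorem ofNat_eq_node {n : ℕ} {l r : Tr} (h : node l r = ofNat n) :
    ∃ m, n = m + 1 ∧ l = leaf ∧ r = ofNat m := by
  cases n with
  | zero => simp [ofNat] at h
  | succ n =>
    simp only [ofNat, node.injEq] at h
    exact ⟨n, rfl, h⟩

theorem ofNat_eq_leaf {n : ℕ} (h : leaf = ofNat n) : n = 0 := by
  cases n with
  | zero => rfl
  | succ n => simp [ofNat] at h

theorem mem_eval_cons {f g : Code} {v w : List ℕ} :
    w ∈ (Code.cons f g).eval v ↔ ∃ a ∈ f.eval v, ∃ b ∈ g.eval v, w = a.headI :: b := by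
  rw [Code.cons_eval]
  simp [Part.bind_eq_bind, Part.mem_bind_iff, Part.pure_eq_some]

theorem mem_eval_comp {f g : Code} {v w : List ℕ} :
    w ∈ (Code.comp f g).eval v ↔ ∃ a ∈ g.eval v, w ∈ f.eval a := by
  rw [Code.comp_eval]
  exact Part.mem_bind_iff

theorem mem_eval_fix {f : Code} {v w : List ℕ} :
    w ∈ (Code.fix f).eval v ↔ ∃ a ∈ f.eval v,
      (a.headI = 0 ∧ w = a.tail) ∨ (a.headI ≠ 0 ∧ w ∈ (Code.fix f).eval a.tail) := by
  rw [Code.fix_eval]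
  refine PFun.mem_fix_iff.trans ?_
  simp only [Part.mem_map_iff]
  constructor
  · rintro (⟨a, ha, h⟩ | ⟨b, ⟨a, ha, h⟩, hb⟩)
    · refine ⟨a, ha, .inl ?_⟩
      split_ifs at h with h0
      exact ⟨h0, (Sum.inl.inj h).symm⟩
    · refine ⟨a, ha, .inr ?_⟩
      split_ifs at h with h0
      obtain rfl := Sum.inr.inj h
      exact ⟨h0, hb⟩
  · rintro ⟨a, ha, ⟨h0, rfl⟩ | ⟨h0, hw⟩⟩
    · exact .inl ⟨a, ha, by simp [h0]⟩
    · exact .inr ⟨a.tail, ⟨a, ha, by simp [h0]⟩, hw⟩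

/-! ### Soundness: the intended interpretation is coherent -/

section Soundness

variable {D : Type} {E : ℕ → D → D → Prop}

/-- Each clause mirrors one case of the evaluation of its program. Its equations supply trees for
input and output, and the correct subderivations supply the intermediate results. -/
theorem good_of_clause {c : Code} {x : D} {cl : List Cond} (hcl : cl ∈ clauses c)
    (h : ∀ k ∈ cl, ¬ k.Fails E (fun u v => ¬ Agree E u v) (fun c y => ¬ Good E c y) x) :
    Good E c x := by
  cases c with
  | zero' =>
    simp only [clauses, List.mem_singleton] at hcl
    subst hcl
    simp only [List.forall_mem_cons, Cond.Fails, agree_iff_along, not_not] at h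
    obtain ⟨h1, ⟨t, h2, h3⟩, -⟩ := h
    exact ⟨t, _, h3, along_node (p := [3]) h1 h2, fun v hv => ⟨0 :: v, by simp, by
      simp [ofList, ofNat, hv]⟩⟩
  | succ =>
    simp only [clauses, List.mem_cons, List.not_mem_nil, or_false] at hcl
    rcases hcl with rfl | rfl <;>
      simp only [List.forall_mem_cons, Cond.Fails, agree_iff_along, not_not] at h
    · obtain ⟨h1, h2, h3, h4, -⟩ := h
      refine ⟨_, _, h1, along_node (p := [3]) (along_node (p := [3, 0]) h2 h3) h4, fun v hv => ?_⟩
      obtain rfl := ofList_eq_leaf hv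
      exact ⟨[1], by simp, by simp [ofList, ofNat]⟩
    -- The reflexive equation along `[2, 1]` is what provides the tree `r` of the input's tail.
    · obtain ⟨h1, ⟨t, h2, h3⟩, h4, ⟨r, h5, -⟩, -⟩ := h
      refine ⟨_, _, along_node (p := [2]) h3 h5,
        along_node (p := [3]) (along_node (p := [3, 0]) h1 h2) h4, fun v hv => ?_⟩
      obtain ⟨n, w, rfl, rfl, rfl⟩ := ofList_eq_node hv
      exact ⟨[n + 1], by simp, by simp [ofList, ofNat]⟩
  | tail =>
    simp only [clauses, List.mem_cons, List.not_mem_nil, or_false] at hcl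
    rcases hcl with rfl | rfl <;>
      simp only [List.forall_mem_cons, Cond.Fails, agree_iff_along, not_not] at h
    · obtain ⟨h1, h2, -⟩ := h
      refine ⟨_, _, h1, h2, fun v hv => ?_⟩
      obtain rfl := ofList_eq_leaf hv
      exact ⟨[], by simp, by simp [ofList]⟩
    · obtain ⟨⟨l, h1, -⟩, ⟨r, h2, h3⟩, -⟩ := h
      refine ⟨_, _, along_node (p := [2]) h1 h2, h3, fun v hv => ?_⟩
      obtain ⟨n, w, rfl, rfl, rfl⟩ := ofList_eq_node hv
      exact ⟨w, by simp, rfl⟩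
  | cons f g =>
    simp only [clauses, List.mem_cons, List.not_mem_nil, or_false] at hcl
    rcases hcl with rfl | rfl <;>
      simp only [List.forall_mem_cons, Cond.Fails, agree_iff_along, not_not] at h
    · obtain ⟨hf, hg, ⟨i, hi, hif⟩, ⟨i', hi', hig⟩, ⟨r, hr, hog⟩, hof, hl, -⟩ := h
      obtain rfl := along_val_unique hi hi'
      refine ⟨_, _, hi, along_node (p := [3]) hl hr, fun v hv => ?_⟩
      obtain ⟨a, ha, hoa⟩ := hf.maps hif hof v hv
      obtain ⟨b, hb, rfl⟩ := hg.maps hig hog v hv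
      obtain rfl := ofList_eq_leaf hoa
      exact ⟨0 :: b, mem_eval_cons.2 ⟨_, ha, b, hb, rfl⟩, rfl⟩
    · obtain ⟨hf, hg, ⟨i, hi, hif⟩, ⟨i', hi', hig⟩, ⟨r, hr, hog⟩, ⟨m, hof, -⟩, ⟨l, hl, hml⟩, -⟩ := h
      obtain rfl := along_val_unique hi hi'
      refine ⟨_, _, hi, along_node (p := [3]) hl hr, fun v hv => ?_⟩
      obtain ⟨m', rfl⟩ := exists_node_of_along (p := [4, 3]) hof hml
      obtain ⟨a, ha, hoa⟩ := hf.maps hif hof v hv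
      obtain ⟨b, hb, rfl⟩ := hg.maps hig hog v hv
      obtain ⟨n, w, rfl, rfl, rfl⟩ := ofList_eq_node hoa
      exact ⟨n :: b, mem_eval_cons.2 ⟨_, ha, b, hb, rfl⟩, rfl⟩
  | comp f g =>
    simp only [clauses, List.mem_singleton] at hcl
    subst hcl
    simp only [List.forall_mem_cons, Cond.Fails, agree_iff_along, not_not] at h
    obtain ⟨hg, hf, ⟨i, hi, hig⟩, ⟨m, hog, hif⟩, ⟨o, ho, hof⟩, -⟩ := h
    refine ⟨_, _, hi, ho, fun v hv => ?_⟩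
    obtain ⟨a, ha, hoa⟩ := hg.maps hig hog v hv
    obtain ⟨b, hb, rfl⟩ := hf.maps hif hof a hoa
    exact ⟨b, mem_eval_comp.2 ⟨a, ha, hb⟩, rfl⟩
  | case f g =>
    simp only [clauses, List.mem_cons, List.not_mem_nil, or_false] at hcl
    rcases hcl with rfl | rfl | rfl <;>
      simp only [List.forall_mem_cons, Cond.Fails, agree_iff_along, not_not] at h
    · obtain ⟨hf, hi, hif, ⟨o, ho, hof⟩, -⟩ := h
      refine ⟨_, _, hi, ho, fun v hv => ?_⟩
      obtain rfl := ofList_eq_leaf hv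
      simpa using hf.maps hif hof [] rfl
    · obtain ⟨hf, hl, ⟨r, hr, hif⟩, ⟨o, ho, hof⟩, -⟩ := h
      refine ⟨_, _, along_node (p := [2]) hl hr, ho, fun v hv => ?_⟩
      obtain ⟨n, w, rfl, hn, rfl⟩ := ofList_eq_node hv
      obtain rfl := ofNat_eq_leaf hn
      simpa using hf.maps hif hof w rfl
    · obtain ⟨hg, hll, ⟨a, hlr, hia⟩, ⟨r, hr, hir⟩, ⟨o, ho, hog⟩, -⟩ := h
      refine ⟨_, _, along_node (p := [2]) (along_node (p := [2, 0]) hll hlr) hr, ho,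
        fun v hv => ?_⟩
      obtain ⟨n, w, rfl, hn, rfl⟩ := ofList_eq_node hv
      obtain ⟨m, rfl, -, rfl⟩ := ofNat_eq_node hn
      simpa using hg.maps (along_node (p := [4, 2]) hia hir) hog (m :: w) rfl
  | fix f =>
    simp only [clauses, List.mem_cons, List.not_mem_nil, or_false] at hcl
    rcases hcl with rfl | rfl | rfl <;>
      simp only [List.forall_mem_cons, Cond.Fails, agree_iff_along, not_not] at h
    · obtain ⟨hf, ⟨i, hi, hif⟩, hof, ho, -⟩ := h
      refine ⟨_, _, hi, ho, fun v hv => ?_⟩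
      obtain ⟨a, ha, hoa⟩ := hf.maps hif hof v hv
      obtain rfl := ofList_eq_leaf hoa
      exact ⟨[], mem_eval_fix.2 ⟨_, ha, .inl ⟨rfl, rfl⟩⟩, rfl⟩
    · obtain ⟨hf, ⟨i, hi, hif⟩, hl, ⟨r, hr, ho⟩, -⟩ := h
      refine ⟨_, _, hi, ho, fun v hv => ?_⟩
      obtain ⟨a, ha, hoa⟩ := hf.maps hif (along_node (p := [4, 3]) hl hr) v hv
      obtain ⟨n, w, rfl, hn, rfl⟩ := ofList_eq_node hoa
      obtain rfl := ofNat_eq_leaf hn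
      exact ⟨w, mem_eval_fix.2 ⟨_, ha, .inl ⟨rfl, rfl⟩⟩, rfl⟩
    · obtain ⟨hf, hg, ⟨i, hi, hif⟩, ⟨m, hof, -⟩, ⟨l, hl, -⟩, ⟨r, hr, hig⟩, ⟨o, ho, hog⟩, -⟩ := h
      refine ⟨_, _, hi, ho, fun v hv => ?_⟩
      obtain ⟨a, ha, rfl⟩ := hf.maps hif hof v hv
      -- A tree along `[4, 3, 0, 0]` shows that the head of the intermediate list has a left child,
      -- hence is a nonzero numeral; this rules out the two stopping cases.
      obtain ⟨y, hy, hy'⟩ := (Along.and (p := [4, 3]) hof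
        ((along_append (p := [4, 3]) (q := [0, 0])).1 hl)).exists
      cases a with
      | nil => exact absurd hy'.1 hy
      | cons n w =>
        cases n with
        | zero =>
          obtain ⟨z, hz, hz'⟩ := (hy.1.and (p := [0]) ((along_append (p := [0]) (q := [0])).1 hy')).exists
          exact absurd hz'.1 hz
        | succ n =>
          obtain rfl := along_val_unique hr (along_right (p := [4, 3]) hof)
          obtain ⟨b, hb, rfl⟩ := hg.maps hig hog w rfl
          exact ⟨b, mem_eval_fix.2 ⟨_, ha, .inr ⟨by simp, hb⟩⟩, rfl⟩

/-- By contraposition: a pair without a reason to disagree represents a common tree, and an element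
satisfying some clause is a correct derivation. No assumption on the structure is needed. -/
theorem coherent_not_good (S : List Code) :
    Coherent E S (fun u v => ¬ Agree E u v) (fun c x => ¬ Good E c x) where
  mis u v h := by
    by_contra hn
    rw [not_and_or, not_or, not_or, not_mis, not_mis] at hn
    simp only [not_not] at hn
    refine h ?_
    rcases hn with ⟨hu, hv⟩ | ⟨hl, hr⟩
    · exact ⟨leaf, hu, hv⟩
    · have key : ∀ r, Along E [r] (fun u => Along E [r] (fun v => Agree E u v) v) u →
          ∃ t, Along E [r] (Val E t) u ∧ Along E [r] (Val E t) v := by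
        intro r hr
        obtain ⟨⟨u', hu'⟩, hr⟩ := hr
        obtain ⟨⟨v', hv'⟩, -⟩ := hr u' hu'
        obtain ⟨t, ht, ht'⟩ := (hr u' hu').2 v' hv'
        refine ⟨t, ⟨⟨u', hu'⟩, fun u1 hu1 => ?_⟩, ⟨⟨v', hv'⟩, fun v1 hv1 => ?_⟩⟩
        · obtain ⟨s, hs, hs'⟩ := (hr u1 hu1).2 v' hv'
          exact hs'.unique ht' ▸ hs
        · obtain ⟨s, hs, hs'⟩ := (hr u' hu').2 v1 hv1
          exact hs.unique ht ▸ hs'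
      obtain ⟨l, hl, hl'⟩ := key 0 hl
      obtain ⟨r, hr, hr'⟩ := key 1 hr
      exact ⟨node l r, ⟨hl, hr⟩, ⟨hl', hr'⟩⟩
  fails c _ x h cl hcl := by
    by_contra! hn
    exact h (good_of_clause hcl hn)

end Soundness

/-! ### Completeness: halting computations have finite derivations -/

section Completeness

/-- Elements of the free structure: data, derivations, and an element with loops. -/
inductive Pt : Type
  | loop : Pt
  | dat (t : Tr) : Pt
  | der (i o : Tr) (d₁ d₂ : Pt) : Pt

/-- `x` has the shape described by an element of the free structure. -/
def Shape {D : Type} (E : ℕ → D → D → Prop) : Pt → D → Prop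
  | .loop, _ => True
  | .dat t, x => Val E t x
  | .der i o d₁ d₂, x => (Along E [2] (Val E i) x ∧ Along E [3] (Val E o) x) ∧
      Along E [4] (Shape E d₁) x ∧ Along E [5] (Shape E d₂) x

/-- The subprograms of `c`. -/
def subcodes : Code → List Code
  | .zero' => [.zero']
  | .succ => [.succ]
  | .tail => [.tail]
  | .cons f g => .cons f g :: (subcodes f ++ subcodes g)
  | .comp f g => .comp f g :: (subcodes f ++ subcodes g)
  | .case f g => .case f g :: (subcodes f ++ subcodes g)
  | .fix f => .fix f :: subcodes f

theorem mem_subcodes_self (c : Code) : c ∈ subcodes c := by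
  cases c <;> simp [subcodes]

/-- Elements of shape `t` are correct derivations of `c v = w`, whatever coherent family `X` is
used. -/
def Derives (t : Pt) (c : Code) (v w : List ℕ) : Prop :=
  ∀ {D : Type} {E : ℕ → D → D → Prop} {S : List Code} {N : D → D → Prop} {X : Code → D → Prop},
    Coherent E S N X → subcodes c ⊆ S → ∀ {x : D}, Shape E t x →
      Along E [2] (Val E (ofList v)) x ∧ Along E [3] (Val E (ofList w)) x ∧ ¬ X c x

theorem Coherent.not_of_clause {D : Type} {E : ℕ → D → D → Prop} {S : List Code}
    {N : D → D → Prop} {X : Code → D → Prop} (h : Coherent E S N X) {c : Code} (hc : c ∈ S)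
    {x : D} {cl : List Cond} (i : ℕ) (hcl : (clauses c)[i]? = some cl)
    (hk : ∀ k ∈ cl, ¬ k.Fails E N X x) : ¬ X c x := fun hx =>
  let ⟨k, hk', hf⟩ := h.fails c hc x hx cl (List.mem_of_getElem? hcl)
  hk k hk' hf

theorem exists_derives_zero (v : List ℕ) : ∃ t, Derives t .zero' v (0 :: v) := by
  -- The unused places for subderivations are filled with `loop`, whose shape imposes no condition.
  refine ⟨.der (ofList v) (ofList (0 :: v)) .loop .loop,
    fun {D E S N X} h hS {x} ⟨⟨hi, ho⟩, _, _⟩ =>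
      ⟨hi, ho, h.not_of_clause (hS (mem_subcodes_self _)) 0 rfl ?_⟩⟩
  simp only [List.forall_mem_cons, Cond.Fails, not_not]
  exact ⟨along_left (p := [3]) ho, not_mis_of_along h (along_right (p := [3]) ho) hi, by simp⟩

theorem exists_derives_succ (v : List ℕ) : ∃ t, Derives t .succ v [v.headI + 1] := by
  refine ⟨.der (ofList v) (ofList [v.headI + 1]) .loop .loop,
    fun {D E S N X} h hS {x} ⟨⟨hi, ho⟩, _, _⟩ => ⟨hi, ho, ?_⟩⟩
  have hl := along_left (p := [3]) ho
  cases v with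
  | nil =>
    refine h.not_of_clause (hS (mem_subcodes_self _)) 0 rfl ?_
    simp only [List.forall_mem_cons, Cond.Fails, not_not]
    exact ⟨hi, along_left (p := [3, 0]) hl, along_right (p := [3, 0]) hl,
      along_right (p := [3]) ho, by simp⟩
  | cons n v =>
    refine h.not_of_clause (hS (mem_subcodes_self _)) 1 rfl ?_
    simp only [List.forall_mem_cons, Cond.Fails, not_not]
    exact ⟨along_left (p := [3, 0]) hl,
      not_mis_of_along h (along_right (p := [3, 0]) hl) (along_left (p := [2]) hi),
      along_right (p := [3]) ho,
      not_mis_of_along h (along_right (p := [2]) hi) (along_right (p := [2]) hi), by simp⟩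

theorem exists_derives_tail (v : List ℕ) : ∃ t, Derives t .tail v v.tail := by
  refine ⟨.der (ofList v) (ofList v.tail) .loop .loop,
    fun {D E S N X} h hS {x} ⟨⟨hi, ho⟩, _, _⟩ => ⟨hi, ho, ?_⟩⟩
  cases v with
  | nil =>
    refine h.not_of_clause (hS (mem_subcodes_self _)) 0 rfl ?_
    simp only [List.forall_mem_cons, Cond.Fails, not_not]
    exact ⟨hi, ho, by simp⟩
  | cons n v =>
    refine h.not_of_clause (hS (mem_subcodes_self _)) 1 rfl ?_
    simp only [List.forall_mem_cons, Cond.Fails]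
    exact ⟨not_mis_of_along h (along_left (p := [2]) hi) (along_left (p := [2]) hi),
      not_mis_of_along h (along_right (p := [2]) hi) ho, by simp⟩

theorem exists_derives_cons {f g : Code} {t s : Pt} {v a b : List ℕ} (hf : Derives t f v a)
    (hg : Derives s g v b) : ∃ t, Derives t (.cons f g) v (a.headI :: b) := by
  refine ⟨.der (ofList v) (ofList (a.headI :: b)) t s,
    fun {D E S N X} h hS {x} ⟨⟨hi, ho⟩, h1, h2⟩ => ⟨hi, ho, ?_⟩⟩
  replace h1 := h1.mono fun y hy => hf h (fun c hc => hS (by simp [subcodes, hc])) hy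
  replace h2 := h2.mono fun y hy => hg h (fun c hc => hS (by simp [subcodes, hc])) hy
  have hif := not_mis_of_along h hi (q := [4, 2]) (h1.mono fun y hy => hy.1)
  have hig := not_mis_of_along h hi (q := [5, 2]) (h2.mono fun y hy => hy.1)
  have hog := not_mis_of_along h (along_right (p := [3]) ho) (q := [5, 3])
    (h2.mono fun y hy => hy.2.1)
  have hof : Along E [4, 3] _ x := h1.mono fun y hy => hy.2.1
  cases a with
  | nil =>
    refine h.not_of_clause (hS (mem_subcodes_self _)) 0 rfl ?_
    simp only [List.forall_mem_cons, Cond.Fails, not_not]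
    exact ⟨h1.mono fun y hy => hy.2.2, h2.mono fun y hy => hy.2.2, hif, hig, hog, hof,
      along_left (p := [3]) ho, by simp⟩
  | cons n w =>
    refine h.not_of_clause (hS (mem_subcodes_self _)) 1 rfl ?_
    simp only [List.forall_mem_cons, Cond.Fails, not_not]
    exact ⟨h1.mono fun y hy => hy.2.2, h2.mono fun y hy => hy.2.2, hif, hig, hog,
      not_mis_of_along h hof hof,
      not_mis_of_along h (along_left (p := [3]) ho) (along_left (p := [4, 3]) hof), by simp⟩

theorem exists_derives_comp {f g : Code} {t s : Pt} {v a b : List ℕ} (hg : Derives t g v a)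
    (hf : Derives s f a b) : ∃ t, Derives t (.comp f g) v b := by
  refine ⟨.der (ofList v) (ofList b) t s,
    fun {D E S N X} h hS {x} ⟨⟨hi, ho⟩, h1, h2⟩ => ⟨hi, ho,
      h.not_of_clause (hS (mem_subcodes_self _)) 0 rfl ?_⟩⟩
  replace h1 := h1.mono fun y hy => hg h (fun c hc => hS (by simp [subcodes, hc])) hy
  replace h2 := h2.mono fun y hy => hf h (fun c hc => hS (by simp [subcodes, hc])) hy
  simp only [List.forall_mem_cons, Cond.Fails, not_not]
  exact ⟨h1.mono fun y hy => hy.2.2, h2.mono fun y hy => hy.2.2,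
    not_mis_of_along h hi (q := [4, 2]) (h1.mono fun y hy => hy.1),
    not_mis_of_along h (p := [4, 3]) (h1.mono fun y hy => hy.2.1) (q := [5, 2])
      (h2.mono fun y hy => hy.1),
    not_mis_of_along h ho (q := [5, 3]) (h2.mono fun y hy => hy.2.1), by simp⟩

theorem exists_derives_case_zero {f g : Code} {t : Pt} {v b : List ℕ} (hv : v.headI = 0)
    (hf : Derives t f v.tail b) : ∃ t, Derives t (.case f g) v b := by
  refine ⟨.der (ofList v) (ofList b) t .loop,
    fun {D E S N X} h hS {x} ⟨⟨hi, ho⟩, h1, _⟩ => ⟨hi, ho, ?_⟩⟩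
  replace h1 := h1.mono fun y hy => hf h (fun c hc => hS (by simp [subcodes, hc])) hy
  have hif : Along E [4, 2] _ x := h1.mono fun y hy => hy.1
  have hof := not_mis_of_along h ho (q := [4, 3]) (h1.mono fun y hy => hy.2.1)
  cases v with
  | nil =>
    refine h.not_of_clause (hS (mem_subcodes_self _)) 0 rfl ?_
    simp only [List.forall_mem_cons, Cond.Fails, not_not]
    exact ⟨h1.mono fun y hy => hy.2.2, hi, hif, hof, by simp⟩
  | cons n v =>
    obtain rfl : n = 0 := hv
    refine h.not_of_clause (hS (mem_subcodes_self _)) 1 rfl ?_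
    simp only [List.forall_mem_cons, Cond.Fails, not_not]
    exact ⟨h1.mono fun y hy => hy.2.2, along_left (p := [2]) hi,
      not_mis_of_along h (along_right (p := [2]) hi) hif, hof, by simp⟩

theorem exists_derives_case_succ {f g : Code} {t : Pt} {n : ℕ} {v b : List ℕ}
    (hg : Derives t g (n :: v) b) : ∃ t, Derives t (.case f g) ((n + 1) :: v) b := by
  refine ⟨.der (ofList ((n + 1) :: v)) (ofList b) t .loop,
    fun {D E S N X} h hS {x} ⟨⟨hi, ho⟩, h1, _⟩ => ⟨hi, ho,
      h.not_of_clause (hS (mem_subcodes_self _)) 2 rfl ?_⟩⟩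
  replace h1 := h1.mono fun y hy => hg h (fun c hc => hS (by simp [subcodes, hc])) hy
  have hig : Along E [4, 2] _ x := h1.mono fun y hy => hy.1
  have hl := along_left (p := [2]) hi
  simp only [List.forall_mem_cons, Cond.Fails, not_not]
  exact ⟨h1.mono fun y hy => hy.2.2, along_left (p := [2, 0]) hl,
    not_mis_of_along h (along_right (p := [2, 0]) hl) (along_left (p := [4, 2]) hig),
    not_mis_of_along h (along_right (p := [2]) hi) (along_right (p := [4, 2]) hig),
    not_mis_of_along h ho (q := [4, 3]) (h1.mono fun y hy => hy.2.1), by simp⟩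

theorem exists_derives_fix_zero {f : Code} {t : Pt} {v a : List ℕ} (ha : a.headI = 0)
    (hf : Derives t f v a) : ∃ t, Derives t (.fix f) v a.tail := by
  refine ⟨.der (ofList v) (ofList a.tail) t .loop,
    fun {D E S N X} h hS {x} ⟨⟨hi, ho⟩, h1, _⟩ => ⟨hi, ho, ?_⟩⟩
  replace h1 := h1.mono fun y hy => hf h (fun c hc => hS (by simp [subcodes, hc])) hy
  have hif := not_mis_of_along h hi (q := [4, 2]) (h1.mono fun y hy => hy.1)
  have hof : Along E [4, 3] _ x := h1.mono fun y hy => hy.2.1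
  cases a with
  | nil =>
    refine h.not_of_clause (hS (mem_subcodes_self _)) 0 rfl ?_
    simp only [List.forall_mem_cons, Cond.Fails, not_not]
    exact ⟨h1.mono fun y hy => hy.2.2, hif, hof, ho, by simp⟩
  | cons n w =>
    obtain rfl : n = 0 := ha
    refine h.not_of_clause (hS (mem_subcodes_self _)) 1 rfl ?_
    simp only [List.forall_mem_cons, Cond.Fails, not_not]
    exact ⟨h1.mono fun y hy => hy.2.2, hif, along_left (p := [4, 3]) hof,
      not_mis_of_along h (along_right (p := [4, 3]) hof) ho, by simp⟩

theorem exists_derives_fix_succ {f : Code} {t s : Pt} {n : ℕ} {v a b : List ℕ}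
    (hf : Derives t f v ((n + 1) :: a)) (hs : Derives s (.fix f) a b) :
    ∃ t, Derives t (.fix f) v b := by
  refine ⟨.der (ofList v) (ofList b) t s,
    fun {D E S N X} h hS {x} ⟨⟨hi, ho⟩, h1, h2⟩ => ⟨hi, ho,
      h.not_of_clause (hS (mem_subcodes_self _)) 2 rfl ?_⟩⟩
  replace h1 := h1.mono fun y hy => hf h (fun c hc => hS (by simp [subcodes, hc])) hy
  replace h2 := h2.mono fun y hy => hs h hS hy
  have hof : Along E [4, 3] _ x := h1.mono fun y hy => hy.2.1
  have hl := along_left (p := [4, 3, 0]) (along_left (p := [4, 3]) hof)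
  simp only [List.forall_mem_cons, Cond.Fails, not_not]
  exact ⟨h1.mono fun y hy => hy.2.2, h2.mono fun y hy => hy.2.2,
    not_mis_of_along h hi (q := [4, 2]) (h1.mono fun y hy => hy.1),
    not_mis_of_along h hof hof, not_mis_of_along h hl hl,
    not_mis_of_along h (along_right (p := [4, 3]) hof) (q := [5, 2]) (h2.mono fun y hy => hy.1),
    not_mis_of_along h ho (q := [5, 3]) (h2.mono fun y hy => hy.2.1), by simp⟩

theorem exists_derives {c : Code} {v w : List ℕ} (h : w ∈ c.eval v) : ∃ t, Derives t c v w := by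
  induction c generalizing v w with
  | zero' =>
    obtain rfl : w = 0 :: v := by simpa using h
    exact exists_derives_zero v
  | succ =>
    obtain rfl : w = [v.headI + 1] := by simpa using h
    exact exists_derives_succ v
  | tail =>
    obtain rfl : w = v.tail := by simpa using h
    exact exists_derives_tail v
  | cons f g ihf ihg =>
    obtain ⟨a, ha, b, hb, rfl⟩ := mem_eval_cons.1 h
    obtain ⟨t, ht⟩ := ihf ha
    obtain ⟨s, hs⟩ := ihg hb
    exact exists_derives_cons ht hs
  | comp f g ihf ihg =>
    obtain ⟨a, ha, hb⟩ := mem_eval_comp.1 h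
    obtain ⟨t, ht⟩ := ihg ha
    obtain ⟨s, hs⟩ := ihf hb
    exact exists_derives_comp ht hs
  | case f g ihf ihg =>
    rw [Code.case_eval] at h
    cases hv : v.headI with
    | zero =>
      simp only [hv] at h
      obtain ⟨t, ht⟩ := ihf h
      exact exists_derives_case_zero hv ht
    | succ n =>
      simp only [hv] at h
      obtain ⟨t, ht⟩ := ihg h
      cases v with
      | nil => simp at hv
      | cons m v =>
        obtain rfl : m = n + 1 := hv
        exact exists_derives_case_succ ht
  | fix f ih =>
    rw [Code.fix_eval] at h
    -- Structural induction on programs does not cover the iterations of `fix`; these are treated by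
    -- a second induction along the terminating run, with the result `w` fixed.
    refine PFun.fixInduction' (C := fun v => ∃ t, Derives t (.fix f) v w) h ?_ ?_
    · intro v hv
      obtain ⟨a, ha, h⟩ := (Part.mem_map_iff _).1 hv
      split_ifs at h with h0
      obtain rfl := Sum.inl.inj h
      obtain ⟨t, ht⟩ := ih ha
      exact exists_derives_fix_zero h0 ht
    · intro v v' _ hv ⟨s, hs⟩
      obtain ⟨a, ha, h⟩ := (Part.mem_map_iff _).1 hv
      split_ifs at h with h0
      obtain rfl := Sum.inr.inj h
      obtain ⟨t, ht⟩ := ih ha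
      cases a with
      | nil => exact absurd rfl h0
      | cons n a =>
        cases n with
        | zero => exact absurd rfl h0
        | succ n => exact exists_derives_fix_succ ht hs

end Completeness

open FOFormula

/-! ### Concepts -/

namespace RelStructure

variable (A : RelStructure)

/-- The interpretation of a role. -/
def role (r : ℕ) (x y : A.dom) : Prop := A.rel ⟨1, r⟩ (![x, y] : Fin 2 → A.dom)

/-- The interpretation of the symbol for disagreement. -/
def mis (x y : A.dom) : Prop := A.rel ⟨2, 1⟩ (![x, y, y] : Fin 3 → A.dom)

/-- The interpretation of a concept name. -/
def unary (k : ℕ) (x : A.dom) : Prop := A.rel ⟨0, k⟩ (fun _ => x)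

/-- The extension of a concept. -/
def Holds (A : RelStructure) : ALCConcept → A.dom → Prop
  | .name k, x => A.unary k x
  | .neg C, x => ¬ A.Holds C x
  | .inter C D, x => A.Holds C x ∧ A.Holds D x
  | .ex r C, x => ∃ y, A.role r x y ∧ A.Holds C y

theorem sat_role {r x y : ℕ} {v : ℕ → A.dom} :
    A.Sat (.rel ⟨1, r⟩ (![x, y] : Fin 2 → ℕ)) v ↔ A.role r (v x) (v y) := by
  have : (fun i => v ((![x, y] : Fin 2 → ℕ) i)) = ![v x, v y] := by
    funext i
    fin_cases i <;> rfl
  exact iff_of_eq (congrArg (A.rel ⟨1, r⟩) this)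

theorem sat_mis {x y : ℕ} {v : ℕ → A.dom} :
    A.Sat (.rel ⟨2, 1⟩ (![x, y, y] : Fin 3 → ℕ)) v ↔ A.mis (v x) (v y) := by
  have : (fun i => v ((![x, y, y] : Fin 3 → ℕ) i)) = ![v x, v y, v y] := by
    funext i
    fin_cases i <;> rfl
  exact iff_of_eq (congrArg (A.rel ⟨2, 1⟩) this)

theorem sat_unary {k x : ℕ} {v : ℕ → A.dom} :
    A.Sat (.rel ⟨0, k⟩ (fun _ => x)) v ↔ A.unary k (v x) := Iff.rfl

theorem sat_toFO (C : ALCConcept) {x y : ℕ} (hxy : x ≠ y) {v : ℕ → A.dom} :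
    A.Sat (C.toFO x y) v ↔ A.Holds C (v x) := by
  induction C generalizing x y v with
  | name k => exact Iff.rfl
  | neg C ih => simp only [ALCConcept.toFO, Sat, Holds, ih hxy]
  | inter C D ihC ihD => simp only [ALCConcept.toFO, Sat, Holds, ihC hxy, ihD hxy]
  | ex r C ih =>
    simp only [ALCConcept.toFO, Sat, Holds, ih hxy.symm]
    refine exists_congr fun d => and_congr ?_ ?_
    · exact A.sat_role.trans (by simp [Function.update_of_ne hxy])
    · simp

/-- Satisfaction depends only on the symbols that occur. -/
theorem sat_congr {D : Type} {hD : Nonempty D} {ρ ρ' : (R : RelSym) → (Fin R.arity → D) → Prop}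
    {κ κ' : ℕ → D} {φ : FOFormula} (h : ∀ R ∈ φ.sig, ρ R = ρ' R) (v : ℕ → D) :
    Sat ⟨D, hD, ρ, κ⟩ φ v ↔ Sat ⟨D, hD, ρ', κ'⟩ φ v := by
  induction φ generalizing v with
  | eq x y => exact Iff.rfl
  | rel R args => exact iff_of_eq (congrFun (h R rfl) _)
  | neg φ ih => exact not_congr (ih h v)
  | conj φ ψ ih ih' =>
    exact and_congr (ih (fun R hR => h R (.inl hR)) v) (ih' (fun R hR => h R (.inr hR)) v)
  | disj φ ψ ih ih' =>
    exact or_congr (ih (fun R hR => h R (.inl hR)) v) (ih' (fun R hR => h R (.inr hR)) v)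
  | ex x φ ih => exact exists_congr fun d => ih h _
  | all x φ ih => exact forall_congr' fun d => ih h _

end RelStructure

namespace ALCConcept

/-- There is no primitive top concept, so some concept name is required; this is why the unary
symbol `⟨0, 0⟩` is put into Σ. -/
def top : ALCConcept := neg (inter (name 0) (neg (name 0)))

/-- There are `r`-successors, and all of them are in `C`. -/
def has (r : ℕ) (C : ALCConcept) : ALCConcept := inter (ex r top) (neg (ex r (neg C)))

def along : List ℕ → ALCConcept → ALCConcept
  | [], C => C
  | r :: p, C => has r (along p C)

/-- The tree `t` is represented. -/
def val : Tr → ALCConcept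
  | .leaf => neg (ex 0 top)
  | .node l r => inter (has 0 (val l)) (has 1 (val r))

/-- The concept that describes an element of the free structure. -/
def shape : Pt → ALCConcept
  | .loop => top
  | .dat t => val t
  | .der i o d₁ d₂ => inter (inter (has 2 (val i)) (has 3 (val o)))
      (inter (has 4 (shape d₁)) (has 5 (shape d₂)))

variable {A : RelStructure}

theorem holds_top {x : A.dom} : A.Holds top x := by
  simp [top, RelStructure.Holds]

theorem holds_has {r : ℕ} {C : ALCConcept} {x : A.dom} :
    A.Holds (has r C) x ↔ Along A.role [r] (A.Holds C) x := by
  simp [has, RelStructure.Holds, Along, holds_top]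

theorem holds_along {p : List ℕ} {C : ALCConcept} {x : A.dom} :
    A.Holds (along p C) x ↔ Along A.role p (A.Holds C) x := by
  induction p generalizing x with
  | nil => exact Iff.rfl
  | cons r p ih =>
    rw [along, holds_has, funext fun y => propext (ih (x := y))]
    rfl

theorem holds_val {t : Tr} {x : A.dom} : A.Holds (val t) x ↔ Val A.role t x := by
  induction t generalizing x with
  | leaf => simp [val, RelStructure.Holds, Val, holds_top]
  | node l r ihl ihr =>
    simp only [val, RelStructure.Holds, Val, holds_has]
    rw [funext fun y => propext (ihl (x := y)), funext fun y => propext (ihr (x := y))]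

theorem holds_shape {t : Pt} {x : A.dom} : A.Holds (shape t) x ↔ Shape A.role t x := by
  induction t generalizing x with
  | loop => exact iff_of_true holds_top trivial
  | dat t => exact holds_val
  | der i o d₁ d₂ ih₁ ih₂ =>
    simp only [shape, RelStructure.Holds, Shape, holds_has]
    rw [funext fun y => propext (ih₁ (x := y)), funext fun y => propext (ih₂ (x := y)),
      funext fun y => propext (holds_val (t := i) (x := y)),
      funext fun y => propext (holds_val (t := o) (x := y))]

/-- Only the name `0` and the roles below `6` occur. -/
def Basic : ALCConcept → Prop
  | name k => k = 0
  | neg C => C.Basic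
  | inter C D => C.Basic ∧ D.Basic
  | ex r C => r < 6 ∧ C.Basic

theorem basic_val (t : Tr) : (val t).Basic := by
  induction t with
  | leaf => simp [val, top, Basic]
  | node l r ihl ihr => simp [val, has, top, Basic, ihl, ihr]

theorem basic_shape (t : Pt) : (shape t).Basic := by
  induction t with
  | loop => simp [shape, top, Basic]
  | dat t => exact basic_val t
  | der i o d₁ d₂ ih₁ ih₂ => simp [shape, has, top, Basic, ih₁, ih₂, basic_val]

theorem sig_toFO {C : ALCConcept} (h : C.Basic) {x y : ℕ} {R : RelSym} (hR : R ∈ (C.toFO x y).sig) :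
    R = ⟨0, 0⟩ ∨ ∃ r < 6, R = ⟨1, r⟩ := by
  induction C generalizing x y with
  | name k =>
    obtain rfl : k = 0 := h
    exact .inl hR
  | neg C ih => exact ih h hR
  | inter C D ihC ihD => exact hR.elim (ihC h.1) (ihD h.2)
  | ex r C ih => exact hR.elim (fun hR => .inr ⟨r, h.1, hR⟩) (ih h.2)

theorem freeVars_toFO (C : ALCConcept) (x y : ℕ) : (C.toFO x y).freeVars ⊆ {x} := by
  induction C generalizing x y with
  | name k => rintro _ ⟨i, rfl⟩; rfl
  | neg C ih => exact ih x y
  | inter C D ihC ihD => exact Set.union_subset (ihC x y) (ihD x y)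
  | ex r C ih =>
    rintro z ⟨⟨i, rfl⟩ | hz, hne⟩
    · revert hne
      refine Fin.cases ?_ (fun j => ?_) i
      · exact fun _ => rfl
      · exact fun hne => absurd (by rw [Subsingleton.elim (α := Fin 1) j 0]; rfl) hne
    · exact absurd (ih y x hz) hne

theorem vars_toFO (C : ALCConcept) (x y : ℕ) : (C.toFO x y).vars ⊆ {x, y} := by
  induction C generalizing x y with
  | name k => rintro _ ⟨i, rfl⟩; exact .inl rfl
  | neg C ih => exact ih x y
  | inter C D ihC ihD => exact Set.union_subset (ihC x y) (ihD x y)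
  | ex r C ih =>
    refine Set.insert_subset (.inr rfl) (Set.union_subset ?_ ?_)
    · rintro _ ⟨i, rfl⟩
      refine Fin.cases (.inl rfl) (fun j => ?_) i
      rw [Subsingleton.elim (α := Fin 1) j 0]
      exact .inr rfl
    · rw [Set.pair_comm]
      exact ih y x

theorem isGuarded_toFO (C : ALCConcept) (x y : ℕ) : IsGuarded (C.toFO x y) := by
  induction C generalizing x y with
  | name k => exact .rel _ _
  | neg C ih => exact .neg (ih x y)
  | inter C D ihC ihD => exact .conj (ihC x y) (ihD x y)
  | ex r C ih =>
    have hy : y ∈ (FOFormula.rel ⟨1, r⟩ (![x, y] : Fin 2 → ℕ)).freeVars := ⟨(1 : Fin 2), rfl⟩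
    refine .exs (ys := [y]) (by simp) (by simp) trivial (by simpa using hy) ?_ (ih y x)
    exact (freeVars_toFO C y x).trans (Set.singleton_subset_iff.2 hy)

end ALCConcept

theorem alc_subset_GF3 : ALC ⊆ GF3 := by
  rintro _ ⟨C, rfl⟩
  exact ⟨C.isGuarded_toFO 0 1, (C.vars_toFO 0 1).trans (by simp [Set.insert_subset_iff])⟩

/-! ### The guarded sentences of the ontology -/

open ALCConcept

/-- An injective numbering of programs. -/
def codeIndex : Code → ℕ
  | .zero' => Nat.pair 0 0
  | .succ => Nat.pair 1 0
  | .tail => Nat.pair 2 0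
  | .cons f g => Nat.pair 3 (Nat.pair (codeIndex f) (codeIndex g))
  | .comp f g => Nat.pair 4 (Nat.pair (codeIndex f) (codeIndex g))
  | .case f g => Nat.pair 5 (Nat.pair (codeIndex f) (codeIndex g))
  | .fix f => Nat.pair 6 (codeIndex f)

theorem codeIndex_injective : Function.Injective codeIndex := by
  intro c
  induction c with
  | zero' | succ | tail => intro d h; cases d <;> simp_all [codeIndex, Nat.pair_eq_pair]
  | cons f g ihf ihg | comp f g ihf ihg | case f g ihf ihg =>
    intro d h
    cases d <;> simp only [codeIndex, Nat.pair_eq_pair] at h <;> try omega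
    rw [ihf h.2.1, ihg h.2.2]
  | fix f ih =>
    intro d h
    cases d <;> simp only [codeIndex, Nat.pair_eq_pair] at h <;> try omega
    rw [ih h.2]

/-- The concept name for elements that are not derivations for `c`. -/
def badName (c : Code) : ALCConcept := .name (codeIndex c + 2)

/-- `Mis` as a formula in `u` and `v`; the symbol `⟨2, 0⟩` serves as a guard. -/
def misFO : List ℕ → List ℕ → ℕ → ℕ → ℕ → FOFormula
  | r :: p, q, u, v, z => disj (neg ((ex r top).toFO u z))
      (ex z (conj (rel ⟨2, 0⟩ (![u, v, z] : Fin 3 → ℕ))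
        (conj (rel ⟨1, r⟩ (![u, z] : Fin 2 → ℕ)) (misFO p q z v u))))
  | [], r :: q, u, v, z => disj (neg ((ex r top).toFO v z))
      (ex z (conj (rel ⟨2, 0⟩ (![u, v, z] : Fin 3 → ℕ))
        (conj (rel ⟨1, r⟩ (![v, z] : Fin 2 → ℕ)) (misFO [] q u z v))))
  | [], [], u, v, _ => rel ⟨2, 1⟩ (![u, v, v] : Fin 3 → ℕ)

/-- Failure of a condition as a formula in `0`. -/
def Cond.toFO : Cond → FOFormula
  | .eqn p q => ex 1 (conj (eq 0 1) (misFO p q 0 1 2))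
  | .leaf p => (neg (along p (val Tr.leaf))).toFO 0 1
  | .child r c => (neg (along [r] (neg (badName c)))).toFO 0 1

def disjs : List FOFormula → FOFormula
  | [] => neg (eq 0 0)
  | φ :: l => disj φ (disjs l)

def conjs : List FOFormula → FOFormula
  | [] => eq 0 0
  | φ :: l => conj φ (conjs l)

/-- Every clause for `c` has a condition that fails. -/
def clausesFO (c : Code) : FOFormula :=
  conjs ((clauses c).map fun cl => disjs (cl.map Cond.toFO))

/-- Only one direction is axiomatized: failure must have a reason, but a reason need not lead to
failure. The offset `2` reserves the unary symbols `⟨0, 0⟩` for Σ and `⟨0, 1⟩` for the goal. -/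
def codeAxiom (c : Code) : FOFormula :=
  alls [0] (imp (rel ⟨0, codeIndex c + 2⟩ (fun _ => 0)) (clausesFO c))

/-- Two elements in disagreement are not both leaves, and their left or their right parts are
missing or disagree. If exactly one is a leaf, the second requirement holds by being stuck. -/
def misAxiom : FOFormula :=
  alls [0, 1] (imp (rel ⟨2, 1⟩ (![0, 1, 1] : Fin 3 → ℕ))
    (conj (disj ((ex 0 top).toFO 0 1) ((ex 0 top).toFO 1 0))
      (disj (misFO [0] [0] 0 1 2) (misFO [1] [1] 0 1 2))))

/-- The symbol `⟨0, 1⟩` contains only elements that are not derivations for `c` with input `n`. -/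
def goalAxiom (c : Code) (n : ℕ) : FOFormula :=
  alls [0] (imp (rel ⟨0, 1⟩ (fun _ => 0))
    ((neg (inter (neg (badName c)) (has 2 (val (ofList [n]))))).toFO 0 1))

/-! ### Membership of the axioms in `GF3` -/

section Guarded

theorem range_pair (r u v : ℕ) :
    @Set.range ℕ (Fin (RelSym.arity ⟨1, r⟩)) (![u, v] : Fin 2 → ℕ) = {u, v} := by
  ext x
  change (∃ i : Fin 2, ![u, v] i = x) ↔ _
  simp [Fin.exists_fin_two, eq_comm]

theorem range_triple (r u v z : ℕ) :
    @Set.range ℕ (Fin (RelSym.arity ⟨2, r⟩)) (![u, v, z] : Fin 3 → ℕ) = {u, v, z} := by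
  ext x
  change (∃ i : Fin 3, ![u, v, z] i = x) ↔ _
  simp [Fin.exists_fin_succ, eq_comm]

theorem freeVars_misFO (p q : List ℕ) (u v z : ℕ) :
    (misFO p q u v z).freeVars ⊆ {u, v} := by
  induction p, q, u, v, z using misFO.induct with
  | case1 r p q u v z ih =>
    have h := freeVars_toFO (ALCConcept.ex r top) u z
    simp only [misFO, freeVars, range_pair, range_triple] at *
    grind
  | case2 r q u v z ih =>
    have h := freeVars_toFO (ALCConcept.ex r top) v z
    simp only [misFO, freeVars, range_pair, range_triple] at *
    grind
  | case3 u v z => rw [misFO]; exact (range_triple 1 u v v).subset.trans (by grind)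

/-- After a move from `u` to `z` the variable `u` is free for reuse, so three variables suffice for
paths of any length. -/
theorem vars_misFO (p q : List ℕ) (u v z : ℕ) :
    (misFO p q u v z).vars ⊆ {u, v, z} := by
  induction p, q, u, v, z using misFO.induct with
  | case1 r p q u v z ih =>
    have h := vars_toFO (ALCConcept.ex r top) u z
    simp only [misFO, vars, range_pair, range_triple, Set.subset_def,
      Set.mem_union, Set.mem_insert_iff, Set.mem_singleton_iff] at *
    grind
  | case2 r q u v z ih =>
    have h := vars_toFO (ALCConcept.ex r top) v z
    simp only [misFO, vars, range_pair, range_triple, Set.subset_def,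
      Set.mem_union, Set.mem_insert_iff, Set.mem_singleton_iff] at *
    grind
  | case3 u v z => rw [misFO]; exact (range_triple 1 u v v).subset.trans (by grind)

theorem isGuarded_ex {z : ℕ} {R : RelSym} {args : Fin R.arity → ℕ} {φ : FOFormula}
    (hz : z ∈ Set.range args) (hφ : φ.freeVars ⊆ Set.range args) (h : IsGuarded φ) :
    IsGuarded (ex z (conj (rel R args) φ)) :=
  .exs (ys := [z]) (by simp) (by simp) (α := rel R args) trivial (by simpa [freeVars] using hz) hφ h

theorem isGuarded_misFO (p q : List ℕ) (u v z : ℕ) : IsGuarded (misFO p q u v z) := by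
  induction p, q, u, v, z using misFO.induct with
  | case1 r p q u v z ih =>
    rw [misFO]
    refine .disj (isGuarded_toFO (.neg (.ex r top)) u z)
      (isGuarded_ex ?_ ?_ (.conj (.rel _ _) ih)) <;> rw [range_triple]
    · simp
    · have := freeVars_misFO p q z v u
      simp only [freeVars, range_pair]
      grind
  | case2 r q u v z ih =>
    rw [misFO]
    refine .disj (isGuarded_toFO (.neg (.ex r top)) v z)
      (isGuarded_ex ?_ ?_ (.conj (.rel _ _) ih)) <;> rw [range_triple]
    · simp
    · have := freeVars_misFO [] q u z v
      simp only [freeVars, range_pair]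
      grind
  | case3 u v z =>
    rw [misFO]
    exact .rel _ _

theorem condFO_mem (k : Cond) :
    IsGuarded k.toFO ∧ k.toFO.vars ⊆ {0, 1, 2} ∧ k.toFO.freeVars ⊆ {0} := by
  have hsub : ({0, 1} : Set ℕ) ⊆ {0, 1, 2} := by grind
  cases k with
  | eqn p q =>
    have h := freeVars_misFO p q 0 1 2
    have h' := vars_misFO p q 0 1 2
    -- The guard is the equality of the variables `0` and `1`, which makes a second copy of the
    -- starting point.
    refine ⟨.exs (ys := [1]) (by simp) (by simp) trivial (by simp [freeVars])
      (by simpa [freeVars] using h) (isGuarded_misFO p q 0 1 2), ?_, ?_⟩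
    · simp only [Cond.toFO, vars]
      grind
    · simp only [Cond.toFO, freeVars]
      grind
  | leaf p => exact ⟨isGuarded_toFO _ 0 1, (vars_toFO _ 0 1).trans hsub, freeVars_toFO _ 0 1⟩
  | child r c => exact ⟨isGuarded_toFO _ 0 1, (vars_toFO _ 0 1).trans hsub, freeVars_toFO _ 0 1⟩

theorem disjs_mem {l : List FOFormula} (h : ∀ φ ∈ l,
    IsGuarded φ ∧ φ.vars ⊆ {0, 1, 2} ∧ φ.freeVars ⊆ {0}) :
    IsGuarded (disjs l) ∧ (disjs l).vars ⊆ {0, 1, 2} ∧ (disjs l).freeVars ⊆ {0} := by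
  induction l with
  | nil => exact ⟨.neg (.eq 0 0), by simp [disjs, vars], by simp [disjs, freeVars]⟩
  | cons φ l ih =>
    obtain ⟨h, hl⟩ := List.forall_mem_cons.1 h
    exact ⟨.disj h.1 (ih hl).1, Set.union_subset h.2.1 (ih hl).2.1,
      Set.union_subset h.2.2 (ih hl).2.2⟩

theorem conjs_mem {l : List FOFormula} (h : ∀ φ ∈ l,
    IsGuarded φ ∧ φ.vars ⊆ {0, 1, 2} ∧ φ.freeVars ⊆ {0}) :
    IsGuarded (conjs l) ∧ (conjs l).vars ⊆ {0, 1, 2} ∧ (conjs l).freeVars ⊆ {0} := by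
  induction l with
  | nil => exact ⟨.eq 0 0, by simp [conjs, vars], by simp [conjs, freeVars]⟩
  | cons φ l ih =>
    obtain ⟨h, hl⟩ := List.forall_mem_cons.1 h
    exact ⟨.conj h.1 (ih hl).1, Set.union_subset h.2.1 (ih hl).2.1,
      Set.union_subset h.2.2 (ih hl).2.2⟩

theorem all_imp_mem {k : ℕ} {φ : FOFormula}
    (h : IsGuarded φ ∧ φ.vars ⊆ {0, 1, 2} ∧ φ.freeVars ⊆ {0}) :
    alls [0] (imp (rel ⟨0, k⟩ (fun _ => 0)) φ) ∈ GF3 ∧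
      (alls [0] (imp (rel ⟨0, k⟩ (fun _ => 0)) φ)).IsSentence := by
  have h0 : (0 : ℕ) ∈ (rel ⟨0, k⟩ (fun _ => 0)).freeVars := ⟨⟨0, Nat.succ_pos _⟩, rfl⟩
  have h1 : (rel ⟨0, k⟩ (fun _ => 0)).vars ⊆ {0} := by rintro _ ⟨i, rfl⟩; rfl
  have h2 : (rel ⟨0, k⟩ (fun _ => 0)).freeVars ⊆ {0} := h1
  obtain ⟨hg, hv, hf⟩ := h
  refine ⟨⟨.alls (by simp) (by simp) trivial (by simpa using h0)
    (hf.trans (Set.singleton_subset_iff.2 h0)) hg, ?_⟩, ?_⟩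
  · simp only [alls, List.foldr, imp, vars]
    grind
  · simp only [alls, List.foldr, imp, freeVars, IsSentence]
    grind

theorem codeAxiom_mem (c : Code) : codeAxiom c ∈ GF3 ∧ (codeAxiom c).IsSentence := by
  refine all_imp_mem (conjs_mem ?_)
  simp only [List.mem_map]
  rintro _ ⟨cl, -, rfl⟩
  refine disjs_mem ?_
  simp only [List.mem_map]
  rintro _ ⟨k, -, rfl⟩
  exact condFO_mem k

theorem goalAxiom_mem (c : Code) (n : ℕ) : goalAxiom c n ∈ GF3 ∧ (goalAxiom c n).IsSentence :=
  all_imp_mem ⟨isGuarded_toFO _ 0 1, (vars_toFO _ 0 1).trans (by grind), freeVars_toFO _ 0 1⟩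

theorem misAxiom_mem : misAxiom ∈ GF3 ∧ misAxiom.IsSentence := by
  have h0 := freeVars_toFO (ALCConcept.ex 0 top) 0 1
  have h1 := freeVars_toFO (ALCConcept.ex 0 top) 1 0
  have h2 := freeVars_misFO [0] [0] 0 1 2
  have h3 := freeVars_misFO [1] [1] 0 1 2
  have g0 := vars_toFO (ALCConcept.ex 0 top) 0 1
  have g1 := vars_toFO (ALCConcept.ex 0 top) 1 0
  have g2 := vars_misFO [0] [0] 0 1 2
  have g3 := vars_misFO [1] [1] 0 1 2
  refine ⟨⟨.alls (by simp) (by simp) trivial ?_ ?_ (.conj (.disj (isGuarded_toFO _ _ _)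
    (isGuarded_toFO _ _ _)) (.disj (isGuarded_misFO _ _ _ _ _) (isGuarded_misFO _ _ _ _ _))),
    ?_⟩, ?_⟩
  · simp [freeVars, range_triple]
  · simp only [range_triple, freeVars]
    grind
  · simp only [misAxiom, alls, List.foldr, imp, vars, range_triple, Set.subset_def,
      Set.mem_union, Set.mem_insert_iff, Set.mem_singleton_iff] at *
    grind
  · simp only [misAxiom, alls, List.foldr, imp, freeVars, range_triple, IsSentence]
    grind

end Guarded

/-! ### The meaning of the ontology -/

section Semantics

variable {A : RelStructure}

theorem sat_disjs {l : List FOFormula} {v : ℕ → A.dom} :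
    A.Sat (disjs l) v ↔ ∃ φ ∈ l, A.Sat φ v := by
  induction l with
  | nil => simp [disjs, RelStructure.Sat]
  | cons φ l ih => simp [disjs, RelStructure.Sat, ih]

theorem sat_conjs {l : List FOFormula} {v : ℕ → A.dom} :
    A.Sat (conjs l) v ↔ ∀ φ ∈ l, A.Sat φ v := by
  induction l with
  | nil => simp [conjs, RelStructure.Sat]
  | cons φ l ih => simp [conjs, RelStructure.Sat, ih]

/-- The guard is simply discarded, so this direction holds in every structure. -/
theorem mis_of_sat_misFO {p q : List ℕ} {u v z : ℕ} {w : ℕ → A.dom} (huv : u ≠ v) (huz : u ≠ z)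
    (hvz : v ≠ z) (h : A.Sat (misFO p q u v z) w) : Mis A.role (A.mis) p q (w u) (w v) := by
  induction p, q, u, v, z using misFO.induct generalizing w with
  | case1 r p q u v z ih =>
    rw [misFO] at h
    rw [Mis]
    rcases h with h | ⟨d, -, h1, h2⟩
    · left
      simpa [A.sat_toFO _ huz, RelStructure.Holds, holds_top, RelStructure.Sat] using h
    · rw [A.sat_role] at h1
      refine .inr ⟨d, by simpa [huz] using h1, ?_⟩
      simpa [hvz] using ih hvz.symm huz.symm huv.symm h2
  | case2 r q u v z ih =>
    rw [misFO] at h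
    rw [Mis]
    rcases h with h | ⟨d, -, h1, h2⟩
    · left
      simpa [A.sat_toFO _ hvz, RelStructure.Holds, holds_top, RelStructure.Sat] using h
    · rw [A.sat_role] at h1
      refine .inr ⟨d, by simpa [hvz] using h1, ?_⟩
      simpa [huz] using ih huz huv hvz.symm h2
  | case3 u v z =>
    rw [misFO] at h
    rw [Mis]
    exact A.sat_mis.1 h

/-- This direction must produce guards, hence the assumption that the guard symbol is total, which
the constructed models satisfy. -/
theorem sat_misFO_of_mis (hG : ∀ a, A.rel ⟨2, 0⟩ a) {p q : List ℕ} {u v z : ℕ} {w : ℕ → A.dom}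
    (huv : u ≠ v) (huz : u ≠ z) (hvz : v ≠ z) (h : Mis A.role (A.mis) p q (w u) (w v)) :
    A.Sat (misFO p q u v z) w := by
  induction p, q, u, v, z using misFO.induct generalizing w with
  | case1 r p q u v z ih =>
    rw [Mis] at h
    rw [misFO]
    rcases h with h | ⟨d, h1, h2⟩
    · left
      simpa [A.sat_toFO _ huz, RelStructure.Holds, holds_top, RelStructure.Sat] using h
    · refine .inr ⟨d, hG _, A.sat_role.2 (by simpa [huz] using h1), ?_⟩
      exact ih hvz.symm huz.symm huv.symm (by simpa [hvz] using h2)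
  | case2 r q u v z ih =>
    rw [Mis] at h
    rw [misFO]
    rcases h with h | ⟨d, h1, h2⟩
    · left
      simpa [A.sat_toFO _ hvz, RelStructure.Holds, holds_top, RelStructure.Sat] using h
    · refine .inr ⟨d, hG _, A.sat_role.2 (by simpa [hvz] using h1), ?_⟩
      exact ih huz huv hvz.symm (by simpa [huz] using h2)
  | case3 u v z =>
    rw [Mis] at h
    rw [misFO]
    exact A.sat_mis.2 h

/-- The interpretation of the names `badName c`. -/
def RelStructure.bad (A : RelStructure) (c : Code) (x : A.dom) : Prop := A.unary (codeIndex c + 2) x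

theorem holds_badName {c : Code} : A.Holds (badName c) = A.bad c := rfl

theorem fails_of_sat {k : Cond} {w : ℕ → A.dom} (h : A.Sat k.toFO w) :
    k.Fails A.role (A.mis) A.bad (w 0) := by
  cases k with
  | eqn p q =>
    obtain ⟨d, h0, h⟩ := h
    obtain rfl : w 0 = d := by simpa [RelStructure.Sat] using h0
    simpa [Cond.Fails] using mis_of_sat_misFO (by simp) (by simp) (by simp) h
  | leaf p =>
    rw [Cond.toFO, A.sat_toFO _ (by simp), RelStructure.Holds, holds_along] at h
    exact fun h' => h (h'.mono fun y => holds_val.2)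
  | child r c =>
    rw [Cond.toFO, A.sat_toFO _ (by simp), RelStructure.Holds, holds_along] at h
    exact h

theorem sat_of_fails (hG : ∀ a, A.rel ⟨2, 0⟩ a) {k : Cond} {w : ℕ → A.dom}
    (h : k.Fails A.role (A.mis) A.bad (w 0)) : A.Sat k.toFO w := by
  cases k with
  | eqn p q =>
    exact ⟨w 0, by simp [RelStructure.Sat],
      sat_misFO_of_mis hG (by simp) (by simp) (by simp) (by simpa [Cond.Fails] using h)⟩
  | leaf p =>
    rw [Cond.toFO, A.sat_toFO _ (by simp), RelStructure.Holds, holds_along]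
    exact fun h' => h (h'.mono fun y => holds_val.1)
  | child r c =>
    rw [Cond.toFO, A.sat_toFO _ (by simp), RelStructure.Holds, holds_along]
    exact h

theorem coherent_of_sat {S : List Code} (hm : ∀ w, A.Sat misAxiom w)
    (hc : ∀ c ∈ S, ∀ w, A.Sat (codeAxiom c) w) : Coherent A.role S (A.mis) A.bad where
  mis u v h := by
    have h1 := (hm (fun _ => u) u v).resolve_left
      (not_not.2 (A.sat_mis.2 (by simpa using h)))
    refine ⟨h1.1.imp (fun h => ?_) (fun h => ?_), h1.2.imp (fun h => ?_) (fun h => ?_)⟩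
    · simpa [A.sat_toFO _ (show (0 : ℕ) ≠ 1 by simp), RelStructure.Holds, holds_top] using h
    · simpa [A.sat_toFO _ (show (1 : ℕ) ≠ 0 by simp), RelStructure.Holds, holds_top] using h
    · simpa using mis_of_sat_misFO (by simp) (by simp) (by simp) h
    · simpa using mis_of_sat_misFO (by simp) (by simp) (by simp) h
  fails c hcS x hx cl hcl := by
    have h1 := (hc c hcS (fun _ => x) x).resolve_left
      (not_not.2 (by simpa [RelStructure.sat_unary, RelStructure.bad] using hx))
    obtain ⟨_, hk, h⟩ := sat_disjs.1 (sat_conjs.1 h1 _ (List.mem_map_of_mem hcl))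
    obtain ⟨k, hk', rfl⟩ := List.mem_map.1 hk
    exact ⟨k, hk', by simpa using fails_of_sat h⟩

theorem sat_misAxiom {S : List Code} (hG : ∀ a, A.rel ⟨2, 0⟩ a)
    (h : Coherent A.role S (A.mis) A.bad) (w : ℕ → A.dom) : A.Sat misAxiom w := by
  intro u v
  refine or_iff_not_imp_left.2 fun hN => ?_
  obtain ⟨h1, h2⟩ := h.mis u v (by simpa using A.sat_mis.1 (not_not.1 hN))
  refine ⟨h1.imp (fun h => ?_) (fun h => ?_), h2.imp (fun h => ?_) (fun h => ?_)⟩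
  · simpa [A.sat_toFO _ (show (0 : ℕ) ≠ 1 by simp), RelStructure.Holds, holds_top] using h
  · simpa [A.sat_toFO _ (show (1 : ℕ) ≠ 0 by simp), RelStructure.Holds, holds_top] using h
  · exact sat_misFO_of_mis hG (by simp) (by simp) (by simp) (by simpa using h)
  · exact sat_misFO_of_mis hG (by simp) (by simp) (by simp) (by simpa using h)

theorem sat_codeAxiom {S : List Code} (hG : ∀ a, A.rel ⟨2, 0⟩ a)
    (h : Coherent A.role S (A.mis) A.bad) {c : Code} (hc : c ∈ S) (w : ℕ → A.dom) :
    A.Sat (codeAxiom c) w := by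
  intro x
  refine or_iff_not_imp_left.2 fun hx => sat_conjs.2 fun φ hφ => ?_
  obtain ⟨cl, hcl, rfl⟩ := List.mem_map.1 hφ
  obtain ⟨k, hk, hf⟩ := h.fails c hc x (not_not.1 hx) cl hcl
  exact sat_disjs.2 ⟨_, List.mem_map_of_mem hk, sat_of_fails hG hf⟩

theorem sat_goalAxiom {c : Code} {n : ℕ} {w : ℕ → A.dom} :
    A.Sat (goalAxiom c n) w ↔ ∀ x, A.unary 1 x →
      ¬ (¬ A.bad c x ∧ Along A.role [2] (Val A.role (ofList [n])) x) := by
  refine forall_congr' fun x => ?_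
  have hs : A.Holds (has 2 (val (ofList [n]))) x ↔
      Along A.role [2] (Val A.role (ofList [n])) x := by
    rw [holds_has, funext fun y => propext (holds_val (A := A) (t := ofList [n]) (x := y))]
  rw [← hs]
  change A.Sat (imp _ _) _ ↔ _
  simp only [imp, RelStructure.Sat, A.sat_toFO _ (show (0 : ℕ) ≠ 1 by simp)]
  simp only [Function.update_self, RelStructure.Holds, holds_badName, RelStructure.unary]
  exact imp_iff_not_or.symm

end Semantics

/-! ### The labeled knowledge base -/

/-- The labeled knowledge base that is separable if and only if `c` halts on `[n]`. -/
def haltingInput (c : Code) (n : ℕ) : Input where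
  ontology := goalAxiom c n :: misAxiom :: (subcodes c).map codeAxiom
  -- The constants `0` and `1` are the positive and the negative example. The loops at the extra
  -- constant `2` put all six roles into the signature of the knowledge base, whatever `c` is.
  database := ⟨⟨0, 1⟩, fun _ => 0⟩ :: ⟨⟨0, 0⟩, fun _ => 1⟩ ::
    (List.range 6).map fun r => ⟨⟨1, r⟩, fun _ => 2⟩
  n := 1
  pos := [fun _ => 0]
  neg := [fun _ => 1]
  signature := ⟨0, 0⟩ :: (List.range 6).map fun r => ⟨1, r⟩

theorem mem_sigma {c : Code} {n : ℕ} {R : RelSym} :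
    R ∈ (haltingInput c n).sigma ↔ R = ⟨0, 0⟩ ∨ ∃ r < 6, R = ⟨1, r⟩ := by
  simp [Input.sigma, haltingInput, eq_comm]

theorem isLabeledKB_haltingInput {L : Set FOFormula} (hL : GF3 ⊆ L) (c : Code) (n : ℕ) :
    (haltingInput c n).IsLabeledKB L where
  ontology_mem φ hφ := by
    have h : φ ∈ GF3 ∧ φ.IsSentence := by
      simp only [haltingInput, List.mem_cons, List.mem_map] at hφ
      rcases hφ with rfl | rfl | ⟨d, -, rfl⟩
      · exact goalAxiom_mem c n
      · exact misAxiom_mem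
      · exact codeAxiom_mem d
    exact ⟨hL h.1, h.2⟩
  pos_nonempty := List.cons_ne_nil _ _
  neg_nonempty := List.cons_ne_nil _ _
  pos_cons a ha i := by
    obtain rfl := List.mem_singleton.1 ha
    exact ⟨_, List.mem_cons_self, ⟨0, Nat.succ_pos _⟩, rfl⟩
  neg_cons a ha i := by
    obtain rfl := List.mem_singleton.1 ha
    exact ⟨_, List.mem_cons_of_mem _ List.mem_cons_self, ⟨0, Nat.succ_pos _⟩, rfl⟩
  sigma_subset R hR := by
    right
    rcases mem_sigma.1 hR with rfl | ⟨r, hr, rfl⟩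
    · exact ⟨_, List.mem_cons_of_mem _ List.mem_cons_self, rfl⟩
    · exact ⟨_, List.mem_cons_of_mem _ (List.mem_cons_of_mem _
        (List.mem_map_of_mem (List.mem_range.2 hr))), rfl⟩

theorem arity_le_of_mem_database {c : Code} {n : ℕ} {g : GroundAtom}
    (hg : g ∈ (haltingInput c n).database) : g.R.arity ≤ 2 := by
  simp only [haltingInput, List.mem_cons, List.mem_map] at hg
  rcases hg with rfl | rfl | ⟨r, -, rfl⟩ <;> simp [RelSym.arity]

/-- The symbols of the knowledge base outside of the signature. -/
def helpers (c : Code) : Set RelSym :=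
  {⟨0, 1⟩, ⟨2, 0⟩, ⟨2, 1⟩} ∪ {R | ∃ d ∈ subcodes c, R = ⟨0, codeIndex d + 2⟩}

/-- Since the helpers occur in the knowledge base but not in Σ, even a projective separator must
avoid them. -/
theorem helpers_subset_sigKB (c : Code) (n : ℕ) : helpers c ⊆ (haltingInput c n).sigKB := by
  have hm : misAxiom ∈ (haltingInput c n).ontology := List.mem_cons_of_mem _ List.mem_cons_self
  rintro R ((rfl | rfl | rfl) | ⟨d, hd, rfl⟩)
  · exact .inr ⟨_, List.mem_cons_self, rfl⟩
  · exact .inl ⟨_, hm, by simp [misAxiom, alls, imp, sig, misFO]⟩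
  · exact .inl ⟨_, hm, by simp [misAxiom, alls, imp, sig]⟩
  · exact .inl ⟨_, List.mem_cons_of_mem _ (List.mem_cons_of_mem _ (List.mem_map_of_mem hd)),
      by simp [codeAxiom, alls, imp, sig]⟩

theorem not_mem_helpers_of_mem_sigma {c : Code} {n : ℕ} {R : RelSym}
    (hR : R ∈ (haltingInput c n).sigma) : R ∉ helpers c := by
  rcases mem_sigma.1 hR with rfl | ⟨r, hr, rfl⟩ <;> simp [helpers]

/-! ### Expansions -/

theorem subcodes_subset {c d : Code} (h : d ∈ subcodes c) : subcodes d ⊆ subcodes c := by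
  induction c with
  | zero' | succ | tail =>
    obtain rfl := List.mem_singleton.1 h
    exact List.Subset.refl _
  | cons f g ihf ihg | comp f g ihf ihg | case f g ihf ihg =>
    simp only [subcodes, List.mem_cons, List.mem_append] at h
    rcases h with rfl | h | h
    · exact List.Subset.refl _
    · exact fun e he => List.mem_cons_of_mem _ (List.mem_append_left _ (ihf h he))
    · exact fun e he => List.mem_cons_of_mem _ (List.mem_append_right _ (ihg h he))
  | fix f ih =>
    simp only [subcodes, List.mem_cons] at h
    rcases h with rfl | h
    · exact List.Subset.refl _
    · exact fun e he => List.mem_cons_of_mem _ (ih h he)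

theorem mem_subcodes_of_child {c d : Code} {r : ℕ} {cl : List Cond} (hcl : cl ∈ clauses c)
    (h : Cond.child r d ∈ cl) : d ∈ subcodes c := by
  cases c <;> simp only [clauses, List.mem_cons, List.not_mem_nil, or_false] at hcl <;>
    rcases hcl with rfl | rfl | rfl <;> simp at h <;>
    grind [subcodes, mem_subcodes_self]

/-- The intended interpretation of the helper symbols, where `st` interprets the goal symbol. -/
def stdRel {D : Type} (E : ℕ → D → D → Prop) (st : D → Prop) :
    (R : RelSym) → (Fin R.arity → D) → Prop
  | ⟨0, 1⟩, a => st (a (0 : Fin 1))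
  | ⟨0, k + 2⟩, a => ∃ d, codeIndex d = k ∧ ¬ Good E d (a (0 : Fin 1))
  | ⟨2, 1⟩, a => ¬ Agree E (a (0 : Fin 3)) (a (1 : Fin 3))
  | _, _ => True

open Classical in
/-- The structure obtained from `A` by reinterpreting the helper symbols and the constants. -/
def expand (c : Code) (A : RelStructure) (st : A.dom → Prop) (κ : ℕ → A.dom) : RelStructure :=
  ⟨A.dom, A.nonempty, fun R => if R ∈ helpers c then stdRel A.role st R else A.rel R, κ⟩

section Expand

variable {c : Code} {A : RelStructure} {st : A.dom → Prop} {κ : ℕ → A.dom}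

theorem expand_rel_of_notMem {R : RelSym} (h : R ∉ helpers c) :
    (expand c A st κ).rel R = A.rel R := if_neg h

theorem expand_rel_of_mem {R : RelSym} (h : R ∈ helpers c) :
    (expand c A st κ).rel R = stdRel A.role st R := if_pos h

theorem expand_role : (expand c A st κ).role = A.role := by
  funext r x y
  -- Every helper is unary or ternary, so all binary symbols are untouched, including those beyond
  -- the six roles.
  exact congrFun (expand_rel_of_notMem (by simp [helpers])) _

theorem expand_guard (a) : (expand c A st κ).rel ⟨2, 0⟩ a := by
  rw [expand_rel_of_mem (by simp [helpers])]
  trivial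

theorem expand_mis : (expand c A st κ).mis = fun u v : A.dom => ¬ Agree A.role u v := by
  funext x y
  exact congrFun (expand_rel_of_mem (by simp [helpers])) _

theorem expand_goal : (expand c A st κ).unary 1 = st := by
  funext x
  exact congrFun (expand_rel_of_mem (by simp [helpers])) _

theorem expand_bad {d : Code} (hd : d ∈ subcodes c) :
    (expand c A st κ).bad d = fun x : A.dom => ¬ Good A.role d x := by
  funext x
  refine (congrFun (expand_rel_of_mem (.inr ⟨d, hd, rfl⟩)) _).trans (propext ?_)
  constructor
  · rintro ⟨e, he, h⟩
    exact codeIndex_injective he ▸ h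
  · exact fun h => ⟨d, rfl, h⟩

/-- Only the names for subprograms of `c` are reinterpreted; this is enough because the conditions
on a subprogram mention subprograms only. -/
theorem coherent_expand : Coherent (expand c A st κ).role (subcodes c) (expand c A st κ).mis
    (expand c A st κ).bad := by
  have h := coherent_not_good (E := A.role) (subcodes c)
  rw [expand_role, expand_mis]
  refine ⟨h.mis, fun d hd x hx cl hcl => ?_⟩
  rw [expand_bad hd] at hx
  obtain ⟨k, hk, hf⟩ := h.fails d hd x hx cl hcl
  refine ⟨k, hk, ?_⟩
  cases k with
  | eqn p q => exact hf
  | leaf p => exact hf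
  | child r e =>
    change ¬ Along A.role [r] (fun y => ¬ (expand c A st κ).bad e y) x
    rw [expand_bad (subcodes_subset hd (mem_subcodes_of_child hcl hk))]
    exact hf

theorem isModel_expand {n : ℕ} (h0 : st (κ 0)) (h1 : A.rel ⟨0, 0⟩ fun _ => κ 1)
    (h2 : ∀ r < 6, A.rel ⟨1, r⟩ fun _ => κ 2)
    (hst : ∀ x, st x → ¬ (Good A.role c x ∧ Along A.role [2] (Val A.role (ofList [n])) x)) :
    (haltingInput c n).IsModel (expand c A st κ) := by
  constructor
  · intro φ hφ w
    simp only [haltingInput, List.mem_cons, List.mem_map] at hφ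
    rcases hφ with rfl | rfl | ⟨d, hd, rfl⟩
    · rw [sat_goalAxiom, expand_goal, expand_role, expand_bad (mem_subcodes_self c)]
      simp only [not_not]
      exact hst
    · exact sat_misAxiom expand_guard coherent_expand w
    · exact sat_codeAxiom expand_guard coherent_expand hd w
  · intro g hg
    simp only [haltingInput, List.mem_cons, List.mem_map, List.mem_range] at hg
    rcases hg with rfl | rfl | ⟨r, hr, rfl⟩
    · exact (congrFun (expand_goal (c := c) (A := A) (st := st) (κ := κ)) (κ 0)).mpr h0
    · rw [expand_rel_of_notMem (by simp [helpers])]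
      exact h1
    · rw [expand_rel_of_notMem (by simp [helpers])]
      exact h2 r hr

end Expand

/-! ### Separability and halting -/

theorem dom_of_separates {c : Code} {n : ℕ} {φ : FOFormula} {x : Fin 1 → ℕ}
    (h : (haltingInput c n).Separates φ x) : (c.eval [n]).Dom := by
  by_contra hn
  refine h.neg _ (List.mem_singleton_self _) fun A hA v hv => ?_
  -- The positive constant now denotes the negative example. With every element a goal element, the
  -- goal axiom holds only because no correct derivation with input `[n]` exists.
  let κ : ℕ → A.dom := Function.update A.const 0 (A.const 1)
  have hB : (haltingInput c n).IsModel (expand c A (fun _ => True) κ) := by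
    refine isModel_expand trivial ?_ ?_ ?_
    · exact hA.2 ⟨⟨0, 0⟩, fun _ => 1⟩ (List.mem_cons_of_mem _ List.mem_cons_self)
    · exact fun r hr => hA.2 ⟨⟨1, r⟩, fun _ => 2⟩ (List.mem_cons_of_mem _
        (List.mem_cons_of_mem _ (List.mem_map.2 ⟨r, List.mem_range.2 hr, rfl⟩)))
    · rintro x - ⟨⟨i, o, hi, -, hm⟩, hi'⟩
      obtain ⟨w, hw, -⟩ := hm [n] (along_val_unique hi hi')
      exact hn (Part.dom_iff_mem.2 ⟨w, hw⟩)
  have hs := h.pos _ (List.mem_singleton_self _) _ hB v fun i => (hv i).trans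
    (Function.update_self 0 (A.const 1) A.const).symm
  refine (RelStructure.sat_congr (fun R hR => ?_) v).1 hs
  refine expand_rel_of_notMem (κ := κ) fun hRh => ?_
  exact not_mem_helpers_of_mem_sigma (h.sig_subset ⟨helpers_subset_sigKB c n hRh, hR⟩) hRh

/-- Successors in the free structure. -/
def Pt.next : ℕ → Pt → Option Pt
  | _, .loop => some .loop
  | 0, .dat (.node l _) => some (.dat l)
  | 1, .dat (.node _ r) => some (.dat r)
  | 2, .der i _ _ _ => some (.dat i)
  | 3, .der _ o _ _ => some (.dat o)
  | 4, .der _ _ d _ => some d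
  | 5, .der _ _ _ d => some d
  | _, _ => none

/-- The free structure. -/
def freeStructure : RelStructure where
  dom := Pt
  nonempty := ⟨.loop⟩
  rel
    | ⟨1, r⟩, a => Pt.next r (a (0 : Fin 2)) = some (a (1 : Fin 2))
    | _, _ => True
  const _ := .loop

theorem freeStructure_role (r : ℕ) (x y : Pt) :
    freeStructure.role r x y ↔ Pt.next r x = some y := Iff.rfl

theorem along_freeStructure {r : ℕ} {x y : Pt} (h : Pt.next r x = some y) {P : Pt → Prop}
    (hP : P y) : Along freeStructure.role [r] P x :=
  ⟨⟨y, h⟩, fun z hz => show P z from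
    (Option.some.inj (h.symm.trans ((freeStructure_role r x z).1 hz)) : y = z) ▸ hP⟩

theorem val_freeStructure (t : Tr) : Val freeStructure.role t (Pt.dat t) := by
  induction t with
  | leaf => rintro ⟨y, h⟩; cases h
  | node l r ihl ihr => exact ⟨along_freeStructure rfl ihl, along_freeStructure rfl ihr⟩

theorem shape_freeStructure (t : Pt) : Shape freeStructure.role t t := by
  induction t with
  | loop => trivial
  | dat t => exact val_freeStructure t
  | der i o d₁ d₂ ih₁ ih₂ =>
    exact ⟨⟨along_freeStructure rfl (val_freeStructure i),
      along_freeStructure rfl (val_freeStructure o)⟩,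
      along_freeStructure rfl ih₁, along_freeStructure rfl ih₂⟩

/-- The looping element has infinite branches and so represents no finite tree, which makes it a
safe denotation for the positive constant. -/
theorem not_val_loop (t : Tr) : ¬ Val freeStructure.role t Pt.loop := by
  induction t with
  | leaf => exact fun h => h ⟨.loop, rfl⟩
  | node l r ihl _ => exact fun h => ihl (h.1.2 .loop rfl)

theorem exists_separates_of_dom {c : Code} {n : ℕ} (h : (c.eval [n]).Dom) :
    ∃ φ ∈ ALC, ∃ x : Fin 1 → ℕ,
      (haltingInput c n).Separates φ x ∧ φ.sig ⊆ (haltingInput c n).sigma := by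
  obtain ⟨w, hw⟩ := Part.dom_iff_mem.1 h
  obtain ⟨t, ht⟩ := exists_derives hw
  have hsig : ((neg (shape t)).toFO 0 1).sig ⊆ (haltingInput c n).sigma :=
    fun R hR => mem_sigma.2 (sig_toFO (C := neg (shape t)) (basic_shape t) hR)
  refine ⟨(neg (shape t)).toFO 0 1, ⟨_, rfl⟩, fun _ => 0, ⟨?_, ?_, ?_, ?_, ?_⟩, hsig⟩
  · exact fun _ _ _ => Subsingleton.elim (α := Fin 1) _ _
  · exact (freeVars_toFO _ 0 1).trans (Set.singleton_subset_iff.2 ⟨(0 : Fin 1), rfl⟩)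
  · exact fun R hR => hsig hR.2
  · intro a ha A hA v hv
    obtain rfl := List.mem_singleton.1 ha
    rw [A.sat_toFO _ (by simp), RelStructure.Holds, holds_shape]
    intro hs
    have hco : Coherent A.role (subcodes c) A.mis A.bad := coherent_of_sat
      (fun w => hA.1 _ (List.mem_cons_of_mem _ List.mem_cons_self) w)
      (fun d hd w => hA.1 _ (List.mem_cons_of_mem _ (List.mem_cons_of_mem _
        (List.mem_map_of_mem hd))) w)
    have hd := ht hco (List.Subset.refl _) hs
    refine sat_goalAxiom.1 (hA.1 _ List.mem_cons_self v) (v 0) ?_ ⟨hd.2.2, hd.1⟩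
    have h0 : v 0 = A.const 0 := hv (0 : Fin 1)
    have := hA.2 ⟨⟨0, 1⟩, fun _ => 0⟩ List.mem_cons_self
    rwa [RelStructure.unary, h0]
  · intro a ha hent
    obtain rfl := List.mem_singleton.1 ha
    -- The negative example is the derivation itself. All other constants denote `loop`, the only
    -- goal element, which also has the loops required at constant `2`.
    let κ : ℕ → Pt := Function.update (fun _ => .loop) 1 t
    have hB : (haltingInput c n).IsModel (expand c freeStructure (· = Pt.loop) κ) := by
      refine isModel_expand rfl trivial (fun r hr => ?_) ?_
      · cases r <;> rfl
      · rintro x rfl ⟨-, h⟩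
        exact not_val_loop _ (h.2 .loop rfl)
    have hs := hent _ hB (fun _ => t) fun i =>
      (Function.update_self 1 t (fun _ => Pt.loop)).symm
    replace hs := (RelStructure.sat_toFO _ _ zero_ne_one).1 hs
    exact hs (holds_shape.2 ((congrArg (fun E : ℕ → Pt → Pt → Prop => Shape E t t)
      expand_role).mpr (shape_freeStructure t)))

/-! ### The reduction is computable -/

/-- The codes of the two translations of a concept. -/
def ALCConcept.codes (C : ALCConcept) : ℕ × ℕ := ((C.toFO 0 1).code, (C.toFO 1 0).code)

def negCodes (a : ℕ × ℕ) : ℕ × ℕ := (Nat.pair 2 a.1, Nat.pair 2 a.2)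

def interCodes (a b : ℕ × ℕ) : ℕ × ℕ :=
  (Nat.pair 3 (Nat.pair a.1 b.1), Nat.pair 3 (Nat.pair a.2 b.2))

/-- An existential restriction swaps the two variables, so each translation is computed from the
other one; hence the recursion on pairs. -/
def exCodes (r : ℕ) (a : ℕ × ℕ) : ℕ × ℕ :=
  (Nat.pair 5 (Nat.pair 1 (Nat.pair 3
      (Nat.pair (rel ⟨1, r⟩ (![0, 1] : Fin 2 → ℕ)).code a.2))),
    Nat.pair 5 (Nat.pair 0 (Nat.pair 3
      (Nat.pair (rel ⟨1, r⟩ (![1, 0] : Fin 2 → ℕ)).code a.1))))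

def hasCodes (r : ℕ) (a : ℕ × ℕ) : ℕ × ℕ :=
  interCodes (ex r top).codes (negCodes (exCodes r (negCodes a)))

theorem codes_neg (C : ALCConcept) : (neg C).codes = negCodes C.codes := by
  simp only [codes, toFO, FOFormula.code, negCodes]

theorem codes_inter (C D : ALCConcept) : (inter C D).codes = interCodes C.codes D.codes := by
  simp only [codes, toFO, FOFormula.code, interCodes]

theorem codes_ex (r : ℕ) (C : ALCConcept) : (ex r C).codes = exCodes r C.codes := by
  rw [codes, toFO, toFO, exCodes, FOFormula.code, FOFormula.code, FOFormula.code, FOFormula.code]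
  rfl

theorem codes_has (r : ℕ) (C : ALCConcept) : (has r C).codes = hasCodes r C.codes := by
  rw [has, codes_inter, codes_neg, codes_ex r (neg C), codes_neg, hasCodes]

theorem codes_val_node (l r : Tr) : (val (node l r)).codes =
    interCodes (hasCodes 0 (val l).codes) (hasCodes 1 (val r).codes) := by
  rw [val, codes_inter, codes_has, codes_has]

theorem primrec_negCodes : Primrec negCodes :=
  (Primrec₂.natPair.comp (.const 2) .fst).pair (Primrec₂.natPair.comp (.const 2) .snd)

theorem primrec_interCodes : Primrec₂ interCodes :=
  (Primrec₂.natPair.comp (.const 3) (Primrec₂.natPair.comp (Primrec.fst.comp .fst)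
      (Primrec.fst.comp .snd))).pair
    (Primrec₂.natPair.comp (.const 3) (Primrec₂.natPair.comp (Primrec.snd.comp .fst)
      (Primrec.snd.comp .snd)))

theorem primrec_exCodes (r : ℕ) : Primrec (exCodes r) :=
  (Primrec₂.natPair.comp (.const 5) (Primrec₂.natPair.comp (.const 1)
      (Primrec₂.natPair.comp (.const 3) (Primrec₂.natPair.comp (.const _) .snd)))).pair
    (Primrec₂.natPair.comp (.const 5) (Primrec₂.natPair.comp (.const 0)
      (Primrec₂.natPair.comp (.const 3) (Primrec₂.natPair.comp (.const _) .fst))))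

theorem primrec_hasCodes (r : ℕ) : Primrec (hasCodes r) :=
  primrec_interCodes.comp (.const _)
    (primrec_negCodes.comp ((primrec_exCodes r).comp primrec_negCodes))

theorem primrec_codes_val_ofNat : Primrec fun n => (val (ofNat n)).codes := by
  refine (Primrec.nat_rec₁ (f := fun _ a => interCodes (hasCodes 0 (val leaf).codes) (hasCodes 1 a))
    (val leaf).codes ?_).of_eq fun n => ?_
  · exact (primrec_interCodes.comp (.const _) ((primrec_hasCodes 1).comp .snd)).to₂
  · induction n with
    | zero => exact congrArg (fun t => (val t).codes) ofNat.eq_1.symm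
    | succ n ih =>
      rw [ofNat, codes_val_node, ← ih]

theorem code_all_imp (φ ψ : FOFormula) : (alls [0] (imp φ ψ)).code =
    Nat.pair 6 (Nat.pair 0 (Nat.pair 4 (Nat.pair (FOFormula.neg φ).code ψ.code))) := by
  simp only [alls, List.foldr, imp, FOFormula.code]

theorem primrec_code_goalAxiom (c : Code) : Primrec fun n => (goalAxiom c n).code := by
  have h : Primrec fun n => (has 2 (val (ofList [n]))).codes := by
    refine ((primrec_hasCodes 2).comp (primrec_interCodes.comp
      ((primrec_hasCodes 0).comp primrec_codes_val_ofNat)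
      (.const (hasCodes 1 (val leaf).codes)))).of_eq fun n => ?_
    rw [ofList, ofList, codes_has 2, codes_val_node]
  have h' : Primrec fun n => ((neg (inter (neg (badName c)) (has 2 (val (ofList [n]))))).toFO 0 1).code := by
    refine (Primrec.fst.comp (primrec_negCodes.comp (primrec_interCodes.comp
      (.const (neg (badName c)).codes) h))).of_eq fun n => ?_
    rw [← codes_inter, ← codes_neg, codes]
  refine (Primrec₂.natPair.comp (.const 6) (Primrec₂.natPair.comp (.const 0)
    (Primrec₂.natPair.comp (.const 4) (Primrec₂.natPair.comp
      (.const (FOFormula.neg (rel ⟨0, 1⟩ (fun _ => 0))).code) h')))).of_eq fun n => ?_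
  rw [goalAxiom, code_all_imp]

/-- With `c` fixed, only the goal axiom varies with `n`; all other components are constants. -/
theorem primrec_code_haltingInput (c : Code) : Primrec fun n => (haltingInput c n).code := by
  have h : Primrec fun n => (haltingInput c n).ontology.map FOFormula.code :=
    Primrec.list_cons.comp (primrec_code_goalAxiom c)
      (.const ((misAxiom :: (subcodes c).map codeAxiom).map FOFormula.code))
  exact Primrec.encode.comp (h.pair (.const (((haltingInput c 0).database.map GroundAtom.code,
    (haltingInput c 0).n, (haltingInput c 0).pos.map tupleCode,
    (haltingInput c 0).neg.map tupleCode, (haltingInput c 0).signature.map RelSym.code))))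

/-- A program for the partial function running the `n`-th partial recursive code on `0` has an
undecidable domain, so a single `c` suffices and only its input varies. -/
theorem exists_code_not_computablePred :
    ∃ c : Code, ¬ ComputablePred fun n => (c.eval [n]).Dom := by
  let f : ℕ →. ℕ := fun n => (Denumerable.ofNat Nat.Partrec.Code n).eval 0
  have hf : Partrec f := Nat.Partrec.Code.eval_part.comp (Computable.ofNat _) (.const 0)
  obtain ⟨c, hc⟩ := Turing.ToPartrec.Code.exists_code (Nat.Partrec'.part_iff₁.2 hf)
  refine ⟨c, fun h => ComputablePred.halting_problem 0 ?_⟩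
  obtain ⟨g, hg, hgf⟩ := ComputablePred.computable_iff.1 h
  refine ComputablePred.computable_iff.2 ⟨fun d => g (Encodable.encode d),
    hg.comp Computable.encode, funext fun d => ?_⟩
  rw [← congrFun hgf]
  have := hc (Encodable.encode d ::ᵥ .nil)
  have h1 : c.eval [Encodable.encode d] = pure <$> f (Encodable.encode d) := this
  rw [h1]
  simp [f]

theorem undecidable_of_halting {c : Code} (hc : ¬ ComputablePred fun n => (c.eval [n]).Dom)
    {adm q : Input → Prop} (hadm : ∀ n, adm (haltingInput c n))
    (hq : ∀ n, q (haltingInput c n) ↔ (c.eval [n]).Dom) : Undecidable adm q := by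
  rintro ⟨f, hf, h⟩
  choose b hb hbq using fun n => h _ (hadm n)
  refine hc (ComputablePred.computable_iff.2 ⟨b, ?_, funext fun n => propext ?_⟩)
  -- The algorithm may diverge on other inputs, but its composition with the reduction is total.
  · exact (hf.comp (primrec_code_haltingInput c).to_comp).of_eq_tot hb
  · rw [← hq, hbq]

end Separability

open Separability in
theorem mainTheorem4 (L : Set Separability.FOFormula) (hL : Separability.GF3 ⊆ L) :
    -- projective and non-projective `L`-separability with signature
    (Separability.Undecidable
        (fun I => I.IsLabeledKB L) (fun I => I.ProjSeparable L) ∧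
      Separability.Undecidable
        (fun I => I.IsLabeledKB L) (fun I => I.NonProjSeparable L)) ∧
    -- the same for separating `ALC`-concepts, where examples are single constants and the
    -- database uses only unary and binary relation symbols
    (Separability.Undecidable
        (fun I => I.IsLabeledKB L ∧ I.n = 1 ∧ ∀ g ∈ I.database, g.R.arity ≤ 2)
        (fun I => I.ProjSeparable Separability.ALC) ∧
      Separability.Undecidable
        (fun I => I.IsLabeledKB L ∧ I.n = 1 ∧ ∀ g ∈ I.database, g.R.arity ≤ 2)
        (fun I => I.NonProjSeparable Separability.ALC)) := by
  obtain ⟨c, hc⟩ := exists_code_not_computablePred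
  have hALC : ALC ⊆ L := alc_subset_GF3.trans hL
  have hadm := isLabeledKB_haltingInput hL c
  have hadm' n : (haltingInput c n).IsLabeledKB L ∧ (haltingInput c n).n = 1 ∧
      ∀ g ∈ (haltingInput c n).database, g.R.arity ≤ 2 :=
    ⟨hadm n, rfl, fun _ => arity_le_of_mem_database⟩
  have hproj {LS} (hLS : ALC ⊆ LS) n :
      (haltingInput c n).ProjSeparable LS ↔ (c.eval [n]).Dom :=
    ⟨fun ⟨_, _, _, h⟩ => dom_of_separates h, fun h =>
      let ⟨φ, hφ, x, hs, _⟩ := exists_separates_of_dom h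
      ⟨φ, hLS hφ, x, hs⟩⟩
  have hnonproj {LS} (hLS : ALC ⊆ LS) n :
      (haltingInput c n).NonProjSeparable LS ↔ (c.eval [n]).Dom :=
    ⟨fun ⟨_, _, _, h, _⟩ => dom_of_separates h, fun h =>
      let ⟨φ, hφ, x, hs⟩ := exists_separates_of_dom h
      ⟨φ, hLS hφ, x, hs⟩⟩
  exact ⟨⟨undecidable_of_halting hc hadm (hproj hALC),
      undecidable_of_halting hc hadm (hnonproj hALC)⟩,
    undecidable_of_halting hc hadm' (hproj subset_rfl),
    undecidable_of_halting hc hadm' (hnonproj subset_rfl)⟩
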